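/- Let $\mathbb{D}$ be the open unit disk and $\mathbb{T}$ the unit circle in $\mathbb{C}$. Let $\mathbb{D}_1^\infty=\ell^1\cap\mathbb{D}^\infty$ and $\mathbb{D}_2^\infty=\ell^2\cap\mathbb{D}^\infty$ (sets of complex sequences, the second one an open subset of the Hilbert space $\ell^2$), and let $m_\infty=\frac{d\theta_1}{2\pi}\times\frac{d\theta_2}{2\pi}\times\cdots$ be the Haar probability measure on $\mathbb{T}^\infty$. For a function $F$ on $\mathbb{D}_1^\infty$ or on $\mathbb{D}_2^\infty$ and $0<r<1$ put $F_{[r]}(w)=F(rw_1,r^2w_2,\ldots,r^nw_n,\ldots)$ for $w\in\mathbb{T}^\infty$, and let $F^*(w)=\lim_{r\to1^-}F_{[r]}(w)$ denote the radial limit. For $0<p<\infty$, $H^p(\mathbb{D}_2^\infty)$ is the set of holomorphic functions $F$ on $\mathbb{D}_2^\infty$ with $\sup_{0<r<1}\int_{\mathbb{T}^\infty}|F_{[r]}|^p\,dm_\infty<\infty$, and $H^\infty(\mathbb{D}_2^\infty)$ is the set of bounded holomorphic functions on $\mathbb{D}_2^\infty$. For every nonzero $F$ in one of these spaces, $F^*(w)$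 exists for almost every $w\in\mathbb{T}^\infty$ and $\log|F^*|\in L^1(\mathbb{T}^\infty,m_\infty)$. Such an $F$ is called outer if for some $\zeta\in\mathbb{D}_1^\infty$ $$\log|F(\zeta)|=\int_{\mathbb{T}^\infty}\mathbf{P}_\zeta\,\log|F^*|\,dm_\infty,\qquad \mathbf{P}_\zeta(w)=\prod_{n=1}^\infty\frac{1-|\zeta_n|^2}{|\zeta_n-w_n|^2},$$ where $\log 0=-\infty$. Corollary. Let $0<p\le\infty$. If $F\in H^p(\mathbb{D}_2^\infty)$ is outer, then $F$ has no zeros in $\mathbb{D}_2^\infty$. -/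

import Mathlib

open MeasureTheory Filter Topology
open scoped ENNReal

noncomputable section

namespace InfPolydisk

/-- The Borel σ-algebra of the unit circle `𝕋`. -/
instance instMeasurableSpaceCircle : MeasurableSpace Circle := borel Circle

instance instBorelSpaceCircle : BorelSpace Circle := ⟨rfl⟩

/-- Normalised Lebesgue measure `dθ / 2π` on the unit circle. -/
def circleMeasure : Measure Circle :=
  Measure.map Circle.exp
    (ENNReal.ofReal (2 * Real.pi)⁻¹ • volume.restrict (Set.Ioc (0 : ℝ) (2 * Real.pi)))

instance instIsProbabilityMeasureCircle : IsProbabilityMeasure circleMeasure := by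
  constructor
  have hpi : (0 : ℝ) < 2 * Real.pi := by positivity
  have hm : Measurable (Circle.exp : ℝ → Circle) := Circle.exp.continuous.measurable
  rw [circleMeasure, Measure.map_apply hm MeasurableSet.univ, Set.preimage_univ,
    Measure.smul_apply, Measure.restrict_apply_univ, Real.volume_Ioc, sub_zero, smul_eq_mul,
    ← ENNReal.ofReal_mul (inv_nonneg.mpr hpi.le), inv_mul_cancel₀ hpi.ne', ENNReal.ofReal_one]

/-- The Haar probability measure `m_∞ = dθ₁/2π × dθ₂/2π × ⋯` on the infinite torus
`𝕋^∞ = (ℕ → Circle)`. -/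
def torusMeasure : Measure (ℕ → Circle) := Measure.infinitePi fun _ : ℕ => circleMeasure

instance instIsProbabilityMeasureTorus : IsProbabilityMeasure torusMeasure := by
  unfold torusMeasure; infer_instance

/-- `𝔻₁^∞ = ℓ¹ ∩ 𝔻^∞`, as a set of complex sequences (the coordinates are indexed from `0`). -/
def polydiskOne : Set (ℕ → ℂ) := {ζ | Memℓp ζ 1 ∧ ∀ n, ‖ζ n‖ < 1}

/-- `𝔻₂^∞ = ℓ² ∩ 𝔻^∞`, as a set of complex sequences (the coordinates are indexed from `0`). -/
def polydiskTwo : Set (ℕ → ℂ) := {ζ | Memℓp ζ 2 ∧ ∀ n, ‖ζ n‖ < 1}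

/-- Holomorphy of a complex-valued function on an open subset `V` of a complex Banach space `X`:
local boundedness on `V`, together with holomorphy of `z ↦ F (x₀ + z x)`, where defined, for all
`x₀ ∈ V` and `x ∈ X`. -/
def HolomorphicOn {X : Type*} [NormedAddCommGroup X] [NormedSpace ℂ X]
    (F : X → ℂ) (V : Set X) : Prop :=
  (∀ x ∈ V, ∃ C : ℝ, ∀ᶠ y in 𝓝[V] x, ‖F y‖ ≤ C) ∧
    ∀ x₀ ∈ V, ∀ x : X, DifferentiableOn ℂ (fun z : ℂ => F (x₀ + z • x)) {z : ℂ | x₀ + z • x ∈ V}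

/-- Holomorphy on `𝔻₂^∞`, regarded as an open subset of the Hilbert space `ℓ²`. Only the values of
`F` at points of `𝔻₂^∞` matter. -/
def HolomorphicOnPolydiskTwo (F : (ℕ → ℂ) → ℂ) : Prop :=
  HolomorphicOn (fun x : lp (fun _ : ℕ => ℂ) 2 => F x)
    {x : lp (fun _ : ℕ => ℂ) 2 | (x : ℕ → ℂ) ∈ polydiskTwo}

/-- The function `F_[r] (w) = F (r w₁, r² w₂, …, rⁿ wₙ, …)` on the infinite torus. The argument
lies in `𝔻₁^∞` when `0 < r < 1`. -/
def dilate (F : (ℕ → ℂ) → ℂ) (r : ℝ) (w : ℕ → Circle) : ℂ :=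
  F fun n => (r : ℂ) ^ (n + 1) * (w n : ℂ)

/-- Membership of `F` in the Hardy space `H^p (𝔻₂^∞)`: the holomorphic functions on `𝔻₂^∞` with
`sup_{0 < r < 1} ∫ |F_[r]|^p dm_∞ < ∞` if `p < ∞`, and the bounded ones if `p = ∞`. -/
def MemHardy (p : ℝ≥0∞) (F : (ℕ → ℂ) → ℂ) : Prop :=
  HolomorphicOnPolydiskTwo F ∧
    (p ≠ ∞ →
      (⨆ r ∈ Set.Ioo (0 : ℝ) 1, ∫⁻ w, ‖dilate F r w‖ₑ ^ p.toReal ∂torusMeasure) < ∞) ∧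
    (p = ∞ → ∃ C : ℝ, ∀ ζ ∈ polydiskTwo, ‖F ζ‖ ≤ C)

/-- The radial limit `F^* (w) = lim_{r → 1⁻} F_[r] (w)`. -/
def radialLimit (F : (ℕ → ℂ) → ℂ) (w : ℕ → Circle) : ℂ :=
  limUnder (𝓝[<] (1 : ℝ)) fun r => dilate F r w

/-- The Poisson kernel `𝐏_ζ (w) = ∏ₙ (1 - |ζₙ|²) / |ζₙ - wₙ|²` of the infinite polydisk, for
`ζ ∈ 𝔻₁^∞`. -/
def torusPoissonKernel (ζ : ℕ → ℂ) (w : ℕ → Circle) : ℝ :=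
  ∏' n, (1 - ‖ζ n‖ ^ 2) / ‖ζ n - (w n : ℂ)‖ ^ 2

/-- `F` is outer: it is not identically zero on `𝔻₁^∞`, and for some `ζ ∈ 𝔻₁^∞` the inequality
`log |F ζ| ≤ ∫ 𝐏_ζ log |F^*| dm_∞` is an equality. The left-hand side is taken in `[-∞, ∞)`, with
`log 0 = -∞`, and only values of `F` on `𝔻₁^∞` are involved. No membership of `F` in the Smirnov
class of `𝔻₁^∞` is demanded here; functions in `H^p (𝔻₂^∞)` belong to it. -/
def IsOuter (F : (ℕ → ℂ) → ℂ) : Prop :=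
  (∃ ζ ∈ polydiskOne, F ζ ≠ 0) ∧
    ∃ ζ ∈ polydiskOne, ENNReal.log ‖F ζ‖ₑ =
      ((∫ w, torusPoissonKernel ζ w * Real.log ‖radialLimit F w‖ ∂torusMeasure : ℝ) : EReal)

end InfPolydisk

end

noncomputable section

namespace InfPolydisk

/-! ### Integration over the unit circle -/

/-! The engine is the Poisson majorant `HasHardyBound.norm_le_exp_integral`: log|F(η)| ≤ ∫ P_η
log|F*| for every η in 𝔻₁^∞. Outerness says that equality holds at one point ζ. Let only the k-th
coordinate z vary. The right side is then the real part of a holomorphic function of z (a Herglotz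
transform), and dividing F by its exponential gives a function of modulus at most 1 on the disk that
attains modulus 1 at z = ζ_k. By the maximum principle its modulus is constant, so equality persists
when one coordinate is changed (`HasHardyBound.norm_eq_update`), hence when finitely many are. The
right side is finite, so F ≠ 0 at every finite modification of ζ (`HasHardyBound.splice_ne_zero`).

Such points approximate every η in 𝔻₂^∞, and a Hurwitz argument
(`HolomorphicOnPolydiskTwo.ne_zero_of_splice`) carries nonvanishing to the limit. On the complex
line through η and ζ, F is a limit of zero-free functions and is not identically zero, since F(ζ) ≠
0.

The majorant takes most of the work. Radial limits exist because F restricted to z ↦ (z w₁, z² w₂,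
…) is, for almost every w, of Nevanlinna type up to a rotation. Fatou's theorem for such functions
follows from the bounded case by writing f = (fh)/h with fh and h bounded. The inequality is first
proved for dilations F_[ρ] and for log max(|·|, ε), which is bounded below and continuous, by
integrating out one coordinate at a time (`logMax_dilate_le_integral`). Then ρ → 1 by uniform
integrability (`HasHardyBound.logMax_le_integral`). Finally ε → 0, where one nonzero value of F
makes log|F*| integrable. -/

lemma integral_circleMeasure {E : Type*} [NormedAddCommGroup E] [NormedSpace ℝ E]
    {g : Circle → E} (hg : AEStronglyMeasurable g circleMeasure) :
    ∫ w, g w ∂circleMeasure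
      = (2 * Real.pi)⁻¹ • ∫ θ in (0 : ℝ)..2 * Real.pi, g (Circle.exp θ) := by
  have hpi : (0 : ℝ) < 2 * Real.pi := by positivity
  rw [circleMeasure, integral_map Circle.exp.continuous.measurable.aemeasurable hg,
    integral_smul_measure, ENNReal.toReal_ofReal (inv_nonneg.mpr hpi.le),
    intervalIntegral.integral_of_le hpi.le]

lemma integral_circleMeasure_eq_circleAverage {E : Type*} [NormedAddCommGroup E] [NormedSpace ℝ E]
    {G : ℂ → E} (hG : AEStronglyMeasurable (fun w : Circle => G w) circleMeasure) :
    ∫ w : Circle, G w ∂circleMeasure = Real.circleAverage G 0 1 := by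
  rw [integral_circleMeasure hG, Real.circleAverage_def]
  simp [circleMap, Circle.coe_exp]

/-- Tested on continuous functions, rotation invariance is the fact that a periodic function has the
same integral over every period. -/
lemma measurePreserving_mul_circle (u : Circle) :
    MeasurePreserving (fun w : Circle => u * w) circleMeasure circleMeasure := by
  have hm : Measurable fun w : Circle => u * w := (continuous_const_mul u).measurable
  refine ⟨hm, ?_⟩
  have : IsProbabilityMeasure (circleMeasure.map fun w : Circle => u * w) :=
    Measure.isProbabilityMeasure_map hm.aemeasurable
  refine ext_of_forall_integral_eq_of_IsFiniteMeasure fun f => ?_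
  have hf : ∀ {h : Circle → ℝ}, Continuous h → AEStronglyMeasurable h circleMeasure :=
    fun h => h.measurable.aestronglyMeasurable
  rw [integral_map hm.aemeasurable f.continuous.measurable.aestronglyMeasurable,
    integral_circleMeasure (hf (h := fun w => f (u * w)) (by fun_prop)),
    integral_circleMeasure (hf f.continuous)]
  congr 1
  obtain ⟨s, rfl⟩ : ∃ s : ℝ, Circle.exp s = u := ⟨_, Circle.exp_arg u⟩
  have hper : Function.Periodic (fun θ : ℝ => f (Circle.exp θ)) (2 * Real.pi) := fun θ => by
    simp [Circle.periodic_exp θ]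
  have := hper.intervalIntegral_add_eq s 0
  rw [zero_add] at this
  rw [← this]
  simpa [Circle.exp_add] using
    intervalIntegral.integral_comp_add_left (a := 0) (b := 2 * Real.pi) (fun θ => f (Circle.exp θ)) s

/-- The Poisson kernel of the unit disk. -/
def diskPoisson (a : ℂ) (w : Circle) : ℝ := (1 - ‖a‖ ^ 2) / ‖a - (w : ℂ)‖ ^ 2

lemma norm_sub_circle_pos {a : ℂ} (ha : ‖a‖ < 1) (w : Circle) : 0 < ‖a - (w : ℂ)‖ := by
  rw [norm_pos_iff, sub_ne_zero]
  rintro rfl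
  exact ha.ne (Circle.norm_coe w)

lemma one_sub_norm_le_norm_sub_circle (a : ℂ) (w : Circle) : 1 - ‖a‖ ≤ ‖a - (w : ℂ)‖ := by
  have := norm_sub_norm_le (w : ℂ) a
  rwa [Circle.norm_coe, norm_sub_rev] at this

lemma norm_sub_circle_le (a : ℂ) (w : Circle) : ‖a - (w : ℂ)‖ ≤ 1 + ‖a‖ := by
  have := norm_sub_le a (w : ℂ)
  rw [Circle.norm_coe] at this
  linarith

lemma diskPoisson_eq_re {a : ℂ} (w : Circle) :
    diskPoisson a w = (((w : ℂ) + a) / ((w : ℂ) - a)).re := by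
  have := congrFun (poissonKernel_eq_re_herglotzRieszKernel (c := 0) (w := a)) (w : ℂ)
  simp only [poissonKernel, herglotzRieszKernel, Function.comp, sub_zero, Circle.norm_coe,
    one_pow] at this
  rw [← this, diskPoisson, norm_sub_rev]

lemma continuous_diskPoisson {a : ℂ} (ha : ‖a‖ < 1) : Continuous (diskPoisson a) := by
  unfold diskPoisson
  refine continuous_const.div (by fun_prop) fun w => ?_
  have := norm_sub_circle_pos ha w
  positivity

lemma diskPoisson_le {a : ℂ} (ha : ‖a‖ < 1) (w : Circle) :
    diskPoisson a w ≤ (1 + ‖a‖) / (1 - ‖a‖) := by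
  have h1 := one_sub_norm_le_norm_sub_circle a w
  have h2 := norm_sub_circle_pos ha w
  have h3 : 0 < 1 - ‖a‖ := by linarith
  rw [diskPoisson, div_le_div_iff₀ (by positivity) h3]
  have : (1 - ‖a‖) ^ 2 ≤ ‖a - (w : ℂ)‖ ^ 2 := by gcongr
  nlinarith [mul_le_mul_of_nonneg_left this (by positivity : 0 ≤ 1 + ‖a‖)]

lemma le_diskPoisson {a : ℂ} (ha : ‖a‖ < 1) (w : Circle) :
    (1 - ‖a‖) / (1 + ‖a‖) ≤ diskPoisson a w := by
  have h1 := norm_sub_circle_le a w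
  have h2 := norm_sub_circle_pos ha w
  have h3 : 0 < 1 - ‖a‖ := by linarith
  rw [diskPoisson, div_le_div_iff₀ (by positivity) (by positivity)]
  have : ‖a - (w : ℂ)‖ ^ 2 ≤ (1 + ‖a‖) ^ 2 := by gcongr
  nlinarith [mul_le_mul_of_nonneg_left this h3.le]

lemma diskPoisson_pos {a : ℂ} (ha : ‖a‖ < 1) (w : Circle) : 0 < diskPoisson a w :=
  (div_pos (by linarith) (by positivity)).trans_le (le_diskPoisson ha w)

lemma integrable_of_continuous_circle {E : Type*} [NormedAddCommGroup E]
    {g : Circle → E} (hg : Continuous g) : Integrable g circleMeasure :=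
  hg.integrable_of_hasCompactSupport (HasCompactSupport.of_compactSpace g)

lemma integral_diskPoisson_smul {f : ℂ → ℂ} (hf : DiffContOnCl ℂ f (Metric.ball 0 1)) {a : ℂ}
    (ha : ‖a‖ < 1) : ∫ w : Circle, diskPoisson a w • f w ∂circleMeasure = f a := by
  have h := hf.circleAverage_poissonKernel_smul' (w := a) (by simpa using ha)
  have hc : ContinuousOn f (Metric.closedBall 0 1) := by
    have := hf.continuousOn
    rwa [closure_ball _ one_ne_zero] at this
  have hfc : Continuous fun w : Circle => f w :=
    hc.comp_continuous (by fun_prop) fun w => by simp [Circle.norm_coe]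
  have hmeas : AEStronglyMeasurable (fun w : Circle =>
      (fun z : ℂ => ((‖z - 0‖ ^ 2 - ‖a - 0‖ ^ 2) / ‖z - 0 - (a - 0)‖ ^ 2) • f z) w)
      circleMeasure := by
    have : Continuous fun w : Circle => diskPoisson a w • f w :=
      (continuous_diskPoisson ha).smul hfc
    refine (integrable_of_continuous_circle this).aestronglyMeasurable.congr (.of_forall fun w => ?_)
    simp [diskPoisson, norm_sub_rev, Circle.norm_coe]
  rw [← integral_circleMeasure_eq_circleAverage hmeas] at h
  rw [← h]
  congr with w
  simp [diskPoisson, norm_sub_rev, Circle.norm_coe]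

lemma integral_diskPoisson {a : ℂ} (ha : ‖a‖ < 1) : ∫ w, diskPoisson a w ∂circleMeasure = 1 := by
  have h := integral_diskPoisson_smul (f := fun _ => 1) (diffContOnCl_const) ha
  simp only [Complex.real_smul, mul_one] at h
  rw [integral_complex_ofReal] at h
  exact_mod_cast h

/-- Trigonometric polynomials P + conj Q are dense, and conjugation does not affect real parts, so
Re(P + Q) approximates equally well. A real boundary function is thus nearly the modulus exponent of
a holomorphic function without harmonic conjugates. -/
lemma exists_polynomial_re_approx {u : Circle → ℝ} (hu : Continuous u) {ε : ℝ} (hε : 0 < ε) :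
    ∃ Q : Polynomial ℂ, ∀ w : Circle, |(Q.eval (w : ℂ)).re - u w| < ε := by
  let e : C(AddCircle (1 : ℝ), Circle) := ⟨_, AddCircle.continuous_toCircle⟩
  let v : C(AddCircle (1 : ℝ), ℂ) :=
    ⟨fun x => (u (e x) : ℂ), Complex.continuous_ofReal.comp (hu.comp e.continuous)⟩
  have hv : v ∈ closure (Submodule.span ℂ (Set.range (@fourier 1)) : Set C(AddCircle (1 : ℝ), ℂ)) := by
    rw [← Submodule.topologicalClosure_coe, span_fourier_closure_eq_top]
    trivial
  obtain ⟨g, hg, hgv⟩ := Metric.mem_closure_iff.mp hv ε hε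
  have key : ∃ P Q : Polynomial ℂ, ∀ x, g x
      = P.eval (e x : ℂ) + (starRingEnd ℂ) (Q.eval (e x : ℂ)) := by
    refine Submodule.span_induction (p := fun g _ => ∃ P Q : Polynomial ℂ, ∀ x, g x
      = P.eval (e x : ℂ) + (starRingEnd ℂ) (Q.eval (e x : ℂ))) ?_ ?_ ?_ ?_ hg
    · rintro _ ⟨n, rfl⟩
      obtain ⟨k, rfl | rfl⟩ := n.eq_nat_or_neg
      · refine ⟨.X ^ k, 0, fun x => ?_⟩
        simp [fourier_apply, e, AddCircle.toCircle_nsmul]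
      · refine ⟨0, .X ^ k, fun x => ?_⟩
        rw [fourier_neg]
        simp [fourier_apply, e, AddCircle.toCircle_nsmul]
    · exact ⟨0, 0, fun x => by simp⟩
    · rintro g₁ g₂ _ _ ⟨P₁, Q₁, h₁⟩ ⟨P₂, Q₂, h₂⟩
      exact ⟨P₁ + P₂, Q₁ + Q₂, fun x => by simp [h₁, h₂]; ring⟩
    · rintro c g₁ _ ⟨P₁, Q₁, h₁⟩
      exact ⟨.C c * P₁, .C (starRingEnd ℂ c) * Q₁, fun x => by simp [h₁]; ring⟩
  obtain ⟨P, Q, hPQ⟩ := key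
  refine ⟨P + Q, fun w => ?_⟩
  obtain ⟨x, rfl⟩ : ∃ x, e x = w := by
    obtain ⟨x, hx⟩ := (AddCircle.homeomorphCircle (one_ne_zero (α := ℝ))).surjective w
    exact ⟨x, (AddCircle.homeomorphCircle_apply one_ne_zero x).symm.trans hx⟩
  have h1 : ‖v x - g x‖ < ε := by
    rw [← dist_eq_norm]; exact (ContinuousMap.dist_apply_le_dist x).trans_lt hgv
  have h2 := (Complex.abs_re_le_norm _).trans_lt h1
  have h3 : (v x - g x).re = u (e x) - ((P + Q).eval (e x : ℂ)).re := by
    simp [hPQ, v]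
  rwa [h3, abs_sub_comm] at h2

/-- Submean value inequality: a majorant of `log ‖f‖` on the circle has Poisson integral
majorising `log ‖f‖` in the disk. -/
lemma norm_le_exp_integral_diskPoisson {f : ℂ → ℂ} (hf : DiffContOnCl ℂ f (Metric.ball 0 1))
    {u : Circle → ℝ} (hu : Continuous u) (hfu : ∀ w : Circle, ‖f w‖ ≤ Real.exp (u w)) {a : ℂ}
    (ha : ‖a‖ < 1) : ‖f a‖ ≤ Real.exp (∫ w, diskPoisson a w * u w ∂circleMeasure) := by
  have hcP := continuous_diskPoisson ha
  have key : ∀ ε > 0, ‖f a‖ ≤ Real.exp (∫ w, diskPoisson a w * u w ∂circleMeasure + 2 * ε) := by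
    intro ε hε
    -- Aiming at u + ε with error ε puts Re Q between u and u + 2ε, so f · exp(-Q) has modulus at
    -- most 1 on the circle.
    obtain ⟨Q, hQ⟩ := exists_polynomial_re_approx (hu.add continuous_const) (u := fun w => u w + ε) hε
    have hQd : DiffContOnCl ℂ (fun z => f z * Complex.exp (-Q.eval z)) (Metric.ball 0 1) :=
      hf.smul (Differentiable.diffContOnCl (by fun_prop))
    have h1 : ‖f a * Complex.exp (-Q.eval a)‖ ≤ 1 := by
      refine Complex.norm_le_of_forall_mem_frontier_norm_le Metric.isBounded_ball hQd ?_
        (subset_closure (by simpa using ha))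
      intro z hz
      rw [frontier_ball _ one_ne_zero] at hz
      have hz1 : ‖z‖ = 1 := by simpa using hz
      let w : Circle := ⟨z, by simpa [Submonoid.unitSphere] using hz1⟩
      have hw : (w : ℂ) = z := rfl
      rw [← hw, norm_mul, Complex.norm_exp, Complex.neg_re]
      have h2 := (abs_lt.mp (hQ w)).1
      calc ‖f w‖ * Real.exp (-(Q.eval (w : ℂ)).re)
          ≤ Real.exp (u w) * Real.exp (-(Q.eval (w : ℂ)).re) := by gcongr; exact hfu w
        _ ≤ 1 := by
          rw [← Real.exp_add, Real.exp_le_one_iff]; linarith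
    have h3 : (Q.eval a).re = ∫ w : Circle, diskPoisson a w * (Q.eval (w : ℂ)).re ∂circleMeasure := by
      rw [← integral_diskPoisson_smul (f := fun z => Q.eval z)
        (Differentiable.diffContOnCl (by fun_prop)) ha]
      have hi : Integrable (fun w : Circle => diskPoisson a w • Q.eval (w : ℂ)) circleMeasure :=
        integrable_of_continuous_circle (by fun_prop)
      have := integral_re hi
      simpa using this.symm
    have h4 : (Q.eval a).re ≤ ∫ w, diskPoisson a w * u w ∂circleMeasure + 2 * ε := by
      have h5 : ∫ w, diskPoisson a w * (u w + 2 * ε) ∂circleMeasure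
          = ∫ w, diskPoisson a w * u w ∂circleMeasure + 2 * ε := by
        simp_rw [mul_add]
        rw [integral_add (integrable_of_continuous_circle (by fun_prop))
          (integrable_of_continuous_circle (by fun_prop)), integral_mul_const,
          integral_diskPoisson ha, one_mul]
      rw [h3, ← h5]
      refine integral_mono (integrable_of_continuous_circle (by fun_prop))
          (integrable_of_continuous_circle (by fun_prop)) fun w => ?_
      have := (abs_lt.mp (hQ w)).2
      exact mul_le_mul_of_nonneg_left (by linarith) (diskPoisson_pos ha w).le
    rw [norm_mul, Complex.norm_exp, Complex.neg_re, Real.exp_neg, ← div_eq_mul_inv,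
      div_le_one (Real.exp_pos _)] at h1
    exact h1.trans (Real.exp_le_exp.mpr h4)
  have hlim : Tendsto (fun ε : ℝ => Real.exp (∫ w, diskPoisson a w * u w ∂circleMeasure + 2 * ε))
      (𝓝[>] 0) (𝓝 (Real.exp (∫ w, diskPoisson a w * u w ∂circleMeasure + 2 * 0))) :=
    ((Continuous.tendsto (by fun_prop) 0).mono_left nhdsWithin_le_nhds)
  rw [mul_zero, add_zero] at hlim
  exact ge_of_tendsto hlim (eventually_nhdsWithin_of_forall key)

/-! ### Radial limits of bounded holomorphic functions on the unit disk -/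

/-- Restricting to rational radii gives a countable family; continuity in r then returns the limit
along all radii. -/
lemma measurableSet_exists_tendsto_one {X : Type*} [MeasurableSpace X] {φ : ℝ → X → ℂ}
    (hm : ∀ r ∈ Set.Ioo (0 : ℝ) 1, Measurable (φ r))
    (hc : ∀ x, ContinuousOn (fun r => φ r x) (Set.Ioo 0 1)) :
    MeasurableSet {x | ∃ c, Tendsto (fun r => φ r x) (𝓝[<] 1) (𝓝 c)} := by
  let ι := {q : ℚ // (q : ℝ) ∈ Set.Ioo (0 : ℝ) 1}
  let l : Filter ι := comap (fun q : ι => ((q : ℚ) : ℝ)) (𝓝[<] 1)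
  have h := MeasureTheory.measurableSet_exists_tendsto (l := l) (f := fun (q : ι) x => φ (q : ℚ) x)
    fun q => hm _ q.2
  convert h using 1
  ext x
  refine exists_congr fun c => ⟨fun h => h.comp tendsto_comap, fun h => ?_⟩
  rw [Metric.tendsto_nhds] at h ⊢
  intro ε hε
  obtain ⟨t, ht, hts⟩ := mem_comap.mp (h (ε / 2) (half_pos hε))
  obtain ⟨a, ha, hat⟩ := (mem_nhdsLT_iff_exists_Ioo_subset' (zero_lt_one)).mp ht
  have h1 : Set.Ioo (max a 0) 1 ∈ 𝓝[<] (1 : ℝ) := Ioo_mem_nhdsLT (by simpa using ha)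
  filter_upwards [h1] with r hr
  have hr0 : r ∈ Set.Ioo (0 : ℝ) 1 := ⟨(le_max_right _ _).trans_lt hr.1, hr.2⟩
  have hcl : r ∈ closure (Set.Ioo (max a 0) 1 ∩ Set.range ((↑) : ℚ → ℝ)) :=
    Dense.open_subset_closure_inter Rat.denseRange_cast isOpen_Ioo hr
  have hcw : ContinuousWithinAt (fun r => φ r x)
      (Set.Ioo (max a 0) 1 ∩ Set.range ((↑) : ℚ → ℝ)) r :=
    ((hc x).continuousAt (Ioo_mem_nhds hr0.1 hr0.2)).continuousWithinAt
  have h2 := hcw.mem_closure hcl (t := Metric.closedBall c (ε / 2)) (by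
    rintro _ ⟨hq, q, rfl⟩
    have hq0 : ((q : ℚ) : ℝ) ∈ Set.Ioo (0 : ℝ) 1 := ⟨(le_max_right _ _).trans_lt hq.1, hq.2⟩
    have h3 : (⟨q, hq0⟩ : ι) ∈ (fun q : ι => ((q : ℚ) : ℝ)) ⁻¹' t :=
      hat ⟨(le_max_left _ _).trans_lt hq.1, hq.2⟩
    have h4 : dist (φ (q : ℝ) x) c < ε / 2 := hts h3
    exact h4.le)
  rw [Metric.isClosed_closedBall.closure_eq, Metric.mem_closedBall] at h2
  exact h2.trans_lt (half_lt_self hε)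

/-- Moving the point ξ radially outward increases its distance to the closed disk. This allows
division by z - (1+η)ξ in place of the singular z - ξ. -/
lemma norm_sub_le_norm_sub_smul {z ξ : ℂ} (hz : ‖z‖ ≤ 1) (hξ : ‖ξ‖ = 1) {η : ℝ} (hη : 0 ≤ η) :
    ‖z - ξ‖ ≤ ‖z - (1 + η : ℝ) * ξ‖ := by
  have h0 : z - (1 + η : ℝ) * ξ = (z - ξ) - (η : ℂ) * ξ := by push_cast; ring
  have h1 : (z * (starRingEnd ℂ) ξ).re ≤ 1 := by
    refine (Complex.re_le_norm _).trans ?_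
    rw [norm_mul, RCLike.norm_conj, hξ, mul_one]; exact hz
  have h2 : ξ.re ^ 2 + ξ.im ^ 2 = 1 := by
    have := Complex.sq_norm ξ
    rw [hξ, Complex.normSq_apply] at this; linarith
  refine (sq_le_sq₀ (norm_nonneg _) (norm_nonneg _)).mp ?_
  rw [h0, Complex.sq_norm, Complex.sq_norm, Complex.normSq_apply, Complex.normSq_apply]
  simp only [Complex.sub_re, Complex.sub_im, Complex.mul_re, Complex.mul_im, Complex.ofReal_re,
    Complex.ofReal_im, Complex.conj_re, Complex.conj_im] at h1 ⊢
  nlinarith [mul_nonneg hη (sub_nonneg.mpr h1), sq_nonneg η]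

/-- A Phragmén–Lindelöf argument for D/(z - ξ), which is bounded by L and small on the circle near
ξ. Multiplying by a high power of the peak function (ξ + z)/(2ξ) makes it small on the whole circle,
hence in the disk; near ξ that power is close to 1 and can be removed. -/
lemma norm_le_of_boundary_little {D : ℂ → ℂ} {L : ℝ} {ξ : ℂ} (hξ : ‖ξ‖ = 1)
    (hD : DiffContOnCl ℂ D (Metric.ball 0 1)) (hL : ∀ z, ‖D z‖ ≤ L * ‖z - ξ‖)
    (hb : ∀ ε > 0, ∃ δ > 0, ∀ z, ‖z‖ = 1 → ‖z - ξ‖ < δ → ‖D z‖ ≤ ε * ‖z - ξ‖) :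
    ∀ ε > 0, ∃ δ > 0, ∀ z, ‖z‖ < 1 → ‖z - ξ‖ < δ → ‖D z‖ ≤ ε * ‖z - ξ‖ := by
  intro ε hε
  have hξ0 : ξ ≠ 0 := by rintro rfl; simp at hξ
  obtain ⟨δ, hδ, hbδ⟩ := hb (ε / 2) (half_pos hε)
  have hψ : ∀ z : ℂ, ‖(ξ + z) / (2 * ξ)‖ = ‖z + ξ‖ / 2 := fun z => by
    simp [hξ, add_comm]
  have hpar : ∀ z : ℂ, ‖z‖ = 1 → ‖z + ξ‖ ^ 2 = 4 - ‖z - ξ‖ ^ 2 := fun z hz => by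
    have := parallelogram_law_with_norm ℝ z ξ
    rw [hz, hξ] at this; nlinarith
  -- By the parallelogram law the peak function has squared modulus 1 - |z - ξ|²/4 on the circle.
  -- The minimum only keeps the radicand nonnegative.
  set q : ℝ := Real.sqrt (1 - min (δ ^ 2 / 4) 1) with hq
  have hq1 : q < 1 := by
    rw [hq, Real.sqrt_lt' one_pos]
    have : 0 < min (δ ^ 2 / 4) 1 := by positivity
    linarith
  have hq0 : 0 ≤ q := Real.sqrt_nonneg _
  have hLq : Tendsto (fun n : ℕ => L * q ^ n) atTop (𝓝 (L * 0)) :=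
    (tendsto_pow_atTop_nhds_zero_of_lt_one hq0 hq1).const_mul L
  rw [mul_zero] at hLq
  obtain ⟨n, hn⟩ := (hLq.eventually_lt_const (half_pos hε)).exists
  have hbd : ∀ z, ‖z‖ = 1 → ‖D z‖ * ‖(ξ + z) / (2 * ξ)‖ ^ n ≤ ε / 2 * ‖z - ξ‖ := by
    intro z hz
    have hle1 : ‖(ξ + z) / (2 * ξ)‖ ≤ 1 := by
      rw [hψ]
      have := norm_add_le z ξ
      rw [hz, hξ] at this; linarith
    rcases lt_or_ge ‖z - ξ‖ δ with h | h
    · calc _ ≤ ‖D z‖ * 1 := by gcongr; exact pow_le_one₀ (norm_nonneg _) hle1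
        _ ≤ _ := by rw [mul_one]; exact hbδ z hz h
    · have hqz : ‖(ξ + z) / (2 * ξ)‖ ≤ q := by
        rw [hψ, hq]
        refine Real.le_sqrt_of_sq_le ?_
        have h2 : δ ^ 2 ≤ ‖z - ξ‖ ^ 2 := by gcongr
        have h3 := min_le_left (δ ^ 2 / 4) 1
        rw [div_pow, hpar z hz]; linarith
      have h0 := (norm_nonneg _).trans (hL z)
      calc _ ≤ (L * ‖z - ξ‖) * q ^ n := by gcongr; exact hL z
        _ = (L * q ^ n) * ‖z - ξ‖ := by ring
        _ ≤ _ := by gcongr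
  have hin : ∀ z, ‖z‖ < 1 → ‖D z‖ * ‖(ξ + z) / (2 * ξ)‖ ^ n ≤ ε / 2 * ‖z - ξ‖ := by
    intro z hz
    have hη : ∀ η > (0 : ℝ), ‖D z‖ * ‖(ξ + z) / (2 * ξ)‖ ^ n ≤ ε / 2 * ‖z - (1 + η : ℝ) * ξ‖ := by
      intro η hη
      have hne : ∀ x : ℂ, ‖x‖ ≤ 1 → x - (1 + η : ℝ) * ξ ≠ 0 := by
        intro x hx h0
        rw [sub_eq_zero] at h0
        rw [h0, norm_mul, hξ, Complex.norm_real, Real.norm_of_nonneg (by positivity)] at hx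
        linarith
      have hd : DiffContOnCl ℂ (fun x => (D x * ((ξ + x) / (2 * ξ)) ^ n) * (x - (1 + η : ℝ) * ξ)⁻¹)
          (Metric.ball 0 1) := by
        have h1 : DiffContOnCl ℂ (fun x : ℂ => ((ξ + x) / (2 * ξ)) ^ n) (Metric.ball 0 1) :=
          Differentiable.diffContOnCl (by fun_prop)
        have h2 : DiffContOnCl ℂ (fun x : ℂ => (x - (1 + η : ℝ) * ξ)⁻¹) (Metric.ball 0 1) := by
          refine DiffContOnCl.inv (Differentiable.diffContOnCl (by fun_prop)) fun x hx => hne x ?_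
          rw [closure_ball _ one_ne_zero] at hx
          simpa using hx
        exact (hD.smul h1).smul h2
      have := Complex.norm_le_of_forall_mem_frontier_norm_le (C := ε / 2) Metric.isBounded_ball hd ?_
        (subset_closure (show z ∈ Metric.ball 0 1 by simpa using hz))
      · rw [norm_mul, norm_inv, ← div_eq_mul_inv, div_le_iff₀ (norm_pos_iff.mpr (hne z hz.le)),
          norm_mul, norm_pow] at this
        exact this
      · intro x hx
        rw [frontier_ball _ one_ne_zero] at hx
        have hx1 : ‖x‖ = 1 := by simpa using hx
        rw [norm_mul, norm_inv, ← div_eq_mul_inv, div_le_iff₀ (norm_pos_iff.mpr (hne x hx1.le)),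
          norm_mul, norm_pow]
        exact (hbd x hx1).trans (by gcongr; exact norm_sub_le_norm_sub_smul hx1.le hξ hη.le)
    have hlim : Tendsto (fun η : ℝ => ε / 2 * ‖z - (1 + η : ℝ) * ξ‖) (𝓝[>] 0)
        (𝓝 (ε / 2 * ‖z - (1 + 0 : ℝ) * ξ‖)) :=
      (Continuous.tendsto (by fun_prop) 0).mono_left nhdsWithin_le_nhds
    have := ge_of_tendsto hlim (eventually_nhdsWithin_of_forall hη)
    simpa using this
  have hψ1 : Tendsto (fun z : ℂ => ‖(ξ + z) / (2 * ξ)‖ ^ n) (𝓝 ξ) (𝓝 (‖(ξ + ξ) / (2 * ξ)‖ ^ n)) :=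
    Continuous.tendsto (by fun_prop) ξ
  rw [← two_mul, div_self (by simpa using hξ0), norm_one, one_pow] at hψ1
  obtain ⟨δ', hδ', h'⟩ := Metric.eventually_nhds_iff.mp
    (hψ1.eventually_const_le (show (1 / 2 : ℝ) < 1 by norm_num))
  refine ⟨δ', hδ', fun z hz hzξ => ?_⟩
  have h1 := hin z hz
  have h2 := h' (by rwa [dist_eq_norm] : dist z ξ < δ')
  nlinarith [mul_le_mul_of_nonneg_left h2 (norm_nonneg (D z))]

/-- Subtracting the first-order part of H at ξ leaves a function that is o(z - ξ) along the circle,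
hence also inside the disk by `norm_le_of_boundary_little`. A Cauchy estimate on disks of radius
proportional to 1 - r then sends its derivative to 0. -/
lemma tendsto_deriv_of_boundary_differentiable {H : ℂ → ℂ} {K : NNReal} (hH : LipschitzWith K H)
    (hd : DifferentiableOn ℂ H (Metric.ball 0 1)) {θ : ℝ}
    (hθ : DifferentiableAt ℝ (fun t : ℝ => H ((Circle.exp t : Circle) : ℂ)) θ) :
    ∃ c, Tendsto (fun r : ℝ => deriv H (r * ((Circle.exp θ : Circle) : ℂ))) (𝓝[<] 1) (𝓝 c) := by
  set ξ : ℂ := ((Circle.exp θ : Circle) : ℂ) with hξdef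
  have hξ : ‖ξ‖ = 1 := Circle.norm_coe _
  have hξ0 : ξ ≠ 0 := by rintro h; simp [h] at hξ
  obtain ⟨d, hdθ⟩ : ∃ d, HasDerivAt (fun t : ℝ => H ((Circle.exp t : Circle) : ℂ)) d θ := ⟨_, hθ.hasDerivAt⟩
  -- The angular derivative of the circle at ξ is iξ, so the complex slope is d/(iξ).
  set c : ℂ := d * (-Complex.I / ξ) with hc
  set D : ℂ → ℂ := fun z => H z - H ξ - c * (z - ξ) with hDdef
  have hDl : D =o[𝓝[Metric.sphere 0 1] ξ] fun z => z - ξ := by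
    -- On the circle the angle arg(z/ξ) equals -i log(z/ξ), which is holomorphic near ξ. This
    -- converts differentiability in θ into a first-order expansion in z.
    have hlog : HasDerivAt (fun z : ℂ => -Complex.I * Complex.log (z / ξ)) (-Complex.I / ξ) ξ := by
      have h1 : HasDerivAt (fun z : ℂ => z / ξ) (1 / ξ) ξ := (hasDerivAt_id ξ).div_const ξ
      have h2 := h1.clog (by rw [div_self hξ0]; simp)
      rw [div_self hξ0, div_one] at h2
      have h3 := h2.const_mul (-Complex.I)
      rwa [mul_one_div] at h3
    have harg : ∀ z ∈ Metric.sphere (0 : ℂ) 1,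
        ((z / ξ).arg : ℂ) = -Complex.I * Complex.log (z / ξ) := by
      intro z hz
      have hz1 : ‖z‖ = 1 := by simpa using hz
      have : Complex.log (z / ξ) = (z / ξ).arg * Complex.I := by
        apply Complex.ext <;> simp [Complex.log_re, Complex.log_im, hz1, hξ]
      rw [this]
      linear_combination ((z / ξ).arg : ℂ) * Complex.I_sq
    have hcont : Tendsto (fun z : ℂ => (z / ξ).arg) (𝓝[Metric.sphere 0 1] ξ) (𝓝 0) := by
      have h1 : ContinuousAt (fun z : ℂ => (z / ξ).arg) ξ :=
        ContinuousAt.comp (g := Complex.arg) (f := fun z => z / ξ)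
          (by rw [div_self hξ0]; exact Complex.continuousAt_arg (by simp)) (by fun_prop)
      have := h1.tendsto
      rw [div_self hξ0, Complex.arg_one] at this
      exact this.mono_left nhdsWithin_le_nhds
    have h1 := ((hasDerivAt_iff_isLittleO_nhds_zero.mp hdθ).comp_tendsto hcont)
    have h2 : (fun z : ℂ => (z / ξ).arg) =O[𝓝[Metric.sphere 0 1] ξ] fun z => z - ξ := by
      have h3 := (hlog.differentiableAt.isBigO_sub).mono
        (nhdsWithin_le_nhds (s := Metric.sphere (0 : ℂ) 1))
      refine (Asymptotics.IsBigO.of_norm_left ?_)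
      refine (h3.norm_left).congr' ?_ (by rfl)
      filter_upwards [self_mem_nhdsWithin] with z hz
      rw [← harg z hz, div_self hξ0]
      simp
    have h3 := h1.trans_isBigO h2
    have h4 := ((hasDerivAt_iff_isLittleO.mp hlog).const_mul_left d).mono
      (nhdsWithin_le_nhds (s := Metric.sphere (0 : ℂ) 1))
    refine (h3.add h4).congr' ?_ (by rfl)
    filter_upwards [self_mem_nhdsWithin] with z hz
    have hz1 : ‖z‖ = 1 := by simpa using hz
    have hexp : ((Circle.exp (θ + (z / ξ).arg) : Circle) : ℂ) = z := by
      rw [Circle.exp_add, Circle.coe_mul, ← hξdef, Circle.coe_exp]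
      have := Complex.norm_mul_exp_arg_mul_I (z / ξ)
      rw [norm_div, hz1, hξ] at this
      simp only [div_one, Complex.ofReal_one, one_mul] at this
      rw [this]; field_simp
    simp only [Function.comp, hexp, ← harg z hz, div_self hξ0, Complex.log_one, hDdef, hc,
      ← hξdef, Complex.real_smul, smul_eq_mul, mul_zero, sub_zero]
    ring
  have hDL : ∀ z, ‖D z‖ ≤ (K + ‖c‖) * ‖z - ξ‖ := fun z => by
    have h1 := hH.dist_le_mul z ξ
    rw [dist_eq_norm, dist_eq_norm] at h1
    have := norm_sub_le (H z - H ξ) (c * (z - ξ))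
    rw [norm_mul] at this
    simp only [hDdef]; linarith
  have hDd : DifferentiableOn ℂ D (Metric.ball 0 1) := by
    simp only [hDdef]
    exact (hd.sub_const _).sub (by fun_prop)
  have hDc : Continuous D := by
    have := hH.continuous
    simp only [hDdef]; fun_prop
  have hb := norm_le_of_boundary_little hξ ⟨hDd, hDc.continuousOn⟩ hDL (by
    intro ε hε
    have := hDl.def hε
    rw [eventually_nhdsWithin_iff, Metric.eventually_nhds_iff] at this
    obtain ⟨δ, hδ, h⟩ := this
    exact ⟨δ, hδ, fun z hz hzξ => h (by rwa [dist_eq_norm]) (by simpa using hz)⟩)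
  refine ⟨c, ?_⟩
  rw [Metric.tendsto_nhds]
  intro ε hε
  obtain ⟨δ, hδ, h⟩ := hb (ε / 4) (by positivity)
  have h1 : Set.Ioo (max 0 (1 - δ / 2)) 1 ∈ 𝓝[<] (1 : ℝ) :=
    Ioo_mem_nhdsLT (by simp [hδ])
  filter_upwards [h1] with r hr
  have hr0 : 0 < r := (le_max_left _ _).trans_lt hr.1
  have hr1 : 1 - δ / 2 < r := (le_max_right _ _).trans_lt hr.1
  have hrξ : ‖(r : ℂ) * ξ‖ = r := by simp [hξ, hr0.le]
  have hR : 0 < (1 - r) / 2 := by linarith [hr.2]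
  have hrξ' : ‖(r : ℂ) * ξ - ξ‖ = 1 - r := by
    rw [show (r : ℂ) * ξ - ξ = ((r - 1 : ℝ) : ℂ) * ξ by push_cast; ring, norm_mul, hξ, mul_one,
      Complex.norm_real, Real.norm_eq_abs, abs_of_neg (by linarith [hr.2])]; ring
  have hsub : Metric.closedBall ((r : ℂ) * ξ) ((1 - r) / 2) ⊆ Metric.ball 0 1 := by
    intro z hz
    rw [mem_closedBall_iff_norm] at hz
    rw [mem_ball_zero_iff]
    have := norm_le_norm_add_norm_sub' z (r * ξ)
    rw [hrξ] at this; linarith [hr.2]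
  -- Points at distance (1 - r)/2 from rξ are within 3(1 - r)/2 of ξ, so the Cauchy bound is 3ε/4.
  have h2 : ‖deriv D ((r : ℂ) * ξ)‖ ≤ (ε / 4 * (3 / 2 * (1 - r))) / ((1 - r) / 2) := by
    refine Complex.norm_deriv_le_of_forall_mem_sphere_norm_le hR ?_ ?_
    · refine DifferentiableOn.diffContOnCl (hDd.mono ?_)
      rwa [closure_ball _ hR.ne']
    · intro z hz
      have hz1 := hsub (Metric.sphere_subset_closedBall hz)
      rw [mem_sphere_iff_norm] at hz
      have h3 : ‖z - ξ‖ ≤ 3 / 2 * (1 - r) := by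
        have := norm_add_le (z - r * ξ) (r * ξ - ξ)
        rw [sub_add_sub_cancel, hz, hrξ'] at this
        linarith
      refine (h z (by simpa using hz1) (by linarith)).trans (by gcongr)
  have hdD : deriv D ((r : ℂ) * ξ) = deriv H ((r : ℂ) * ξ) - c := by
    have hHd : HasDerivAt H (deriv H ((r : ℂ) * ξ)) ((r : ℂ) * ξ) :=
      (hd.differentiableAt (Metric.isOpen_ball.mem_nhds (by
        rw [mem_ball_zero_iff, hrξ]; exact hr.2))).hasDerivAt
    have h5 := (hHd.sub_const (H ξ)).sub (((hasDerivAt_id ((r : ℂ) * ξ)).sub_const ξ).const_mul c)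
    rw [mul_one] at h5
    exact h5.deriv
  rw [dist_eq_norm, ← hdD]
  refine h2.trans_lt ?_
  rw [div_lt_iff₀ hR]
  nlinarith

/-- Fatou's theorem for bounded holomorphic functions. -/
lemma ae_exists_radial_limit_of_bounded {f : ℂ → ℂ} (hf : DifferentiableOn ℂ f (Metric.ball 0 1))
    {M : ℝ} (hM : ∀ z, ‖z‖ < 1 → ‖f z‖ ≤ M) :
    ∀ᵐ w : Circle ∂circleMeasure, ∃ c, Tendsto (fun r : ℝ => f (r * w)) (𝓝[<] 1) (𝓝 c) := by
  have hmem : ∀ (w : Circle), ∀ r ∈ Set.Ioo (0 : ℝ) 1, (r : ℂ) * w ∈ Metric.ball (0 : ℂ) 1 := by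
    intro w r hr
    simp [Circle.norm_coe, abs_of_pos hr.1, hr.2]
  have hms : MeasurableSet {w : Circle | ∃ c, Tendsto (fun r : ℝ => f (r * w)) (𝓝[<] 1) (𝓝 c)} := by
    refine measurableSet_exists_tendsto_one (φ := fun r (w : Circle) => f (r * w)) ?_ ?_
    · intro r hr
      exact (hf.continuousOn.comp_continuous (by fun_prop) fun w => hmem w r hr).measurable
    · intro w
      exact hf.continuousOn.comp (by fun_prop) fun r hr => hmem w r hr
  -- A primitive of a bounded function is Lipschitz. Its Lipschitz extension is differentiable in θ
  -- almost everywhere on the circle, and f is the derivative of the primitive.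
  obtain ⟨H₀, hH₀⟩ := hf.isExactOn_ball
  have hlip : LipschitzOnWith M.toNNReal H₀ (Metric.ball 0 1) :=
    (convex_ball 0 1).lipschitzOnWith_of_nnnorm_hasDerivWithin_le
      (fun z hz => (hH₀ z hz).hasDerivWithinAt) fun z hz => by
        rw [← NNReal.coe_le_coe, coe_nnnorm]
        exact (hM z (by simpa using hz)).trans (Real.le_coe_toNNReal M)
  obtain ⟨H, hH, heq⟩ := hlip.extend_finite_dimension
  have hder : ∀ z ∈ Metric.ball (0 : ℂ) 1, HasDerivAt H (f z) z := fun z hz =>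
    (hH₀ z hz).congr_of_eventuallyEq
      (Filter.eventuallyEq_of_mem (Metric.isOpen_ball.mem_nhds hz) heq.symm)
  have hlipexp : LipschitzWith 1 fun t : ℝ => ((Circle.exp t : Circle) : ℂ) := by
    convert lipschitzWith_circleMap 0 1 using 1
    · simp
    · ext t; simp [circleMap, Circle.coe_exp]
  have hae := (hH.comp hlipexp).ae_differentiableAt_real
  rw [circleMeasure, ae_map_iff Circle.exp.continuous.measurable.aemeasurable hms]
  refine Measure.ae_smul_measure (ae_restrict_of_ae ?_) _
  filter_upwards [hae] with θ hθ
  obtain ⟨c, hc⟩ := tendsto_deriv_of_boundary_differentiable hH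
    (fun z hz => (hder z hz).differentiableAt.differentiableWithinAt) hθ
  refine ⟨c, hc.congr' ?_⟩
  have h1 : Set.Ioo (0 : ℝ) 1 ∈ 𝓝[<] (1 : ℝ) := Ioo_mem_nhdsLT one_pos
  filter_upwards [h1] with r hr
  exact (hder _ (hmem _ r hr)).deriv

/-! ### Truncated logarithms and Fatou's theorem for the Nevanlinna class -/

/-- The truncated logarithm `log (max x ε)`. -/
def logMax (ε x : ℝ) : ℝ := Real.log (max x ε)

lemma continuous_logMax {ε : ℝ} (hε : 0 < ε) : Continuous (logMax ε) := by
  unfold logMax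
  exact (continuous_id.max continuous_const).log fun x => (hε.trans_le (le_max_right _ _)).ne'

lemma exp_logMax {ε : ℝ} (hε : 0 < ε) (x : ℝ) : Real.exp (logMax ε x) = max x ε :=
  Real.exp_log (hε.trans_le (le_max_right _ _))

lemma le_exp_logMax {ε : ℝ} (hε : 0 < ε) (x : ℝ) : x ≤ Real.exp (logMax ε x) :=
  (le_max_left _ _).trans_eq (exp_logMax hε x).symm

lemma log_le_logMax {ε : ℝ} (hε : 0 < ε) (x : ℝ) : Real.log ε ≤ logMax ε x :=
  Real.log_le_log hε (le_max_right _ _)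

lemma logMax_mono {ε : ℝ} (hε : 0 < ε) : Monotone (logMax ε) := fun _ _ h =>
  Real.log_le_log (hε.trans_le (le_max_right _ _)) (max_le_max_right _ h)

/-- The function log max(|f|, ε) is subharmonic, being the maximum of log|f| and a constant, and it
stays continuous at the zeros of f. -/
lemma logMax_le_integral_diskPoisson {f : ℂ → ℂ} (hf : DiffContOnCl ℂ f (Metric.ball 0 1))
    {ε : ℝ} (hε : 0 < ε) {a : ℂ} (ha : ‖a‖ < 1) :
    logMax ε ‖f a‖ ≤ ∫ w : Circle, diskPoisson a w * logMax ε ‖f w‖ ∂circleMeasure := by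
  have hfc : Continuous fun w : Circle => f w :=
    hf.continuousOn.comp_continuous (by fun_prop) fun w => by
      rw [closure_ball _ one_ne_zero]; simp [Circle.norm_coe]
  have hu : Continuous fun w : Circle => logMax ε ‖f w‖ := (continuous_logMax hε).comp hfc.norm
  have hP := continuous_diskPoisson ha
  rw [← Real.exp_le_exp, exp_logMax hε]
  refine max_le (norm_le_exp_integral_diskPoisson hf hu (fun w => le_exp_logMax hε _) ha) ?_
  rw [← Real.log_le_iff_le_exp hε]
  calc Real.log ε = ∫ w : Circle, diskPoisson a w * Real.log ε ∂circleMeasure := by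
        rw [integral_mul_const, integral_diskPoisson ha, one_mul]
    _ ≤ _ := by
        refine integral_mono (integrable_of_continuous_circle (by fun_prop))
          (integrable_of_continuous_circle (by fun_prop)) fun w => ?_
        exact mul_le_mul_of_nonneg_left (log_le_logMax hε _) (diskPoisson_pos ha w).le

lemma diffContOnCl_dilate {f : ℂ → ℂ} (hf : DifferentiableOn ℂ f (Metric.ball 0 1)) {r : ℝ}
    (hr : r ∈ Set.Ioo (0 : ℝ) 1) : DiffContOnCl ℂ (fun z => f (r * z)) (Metric.ball 0 1) := by
  refine DifferentiableOn.diffContOnCl ?_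
  rw [closure_ball _ one_ne_zero]
  refine hf.comp (by fun_prop) fun z hz => ?_
  rw [mem_closedBall_zero_iff] at hz
  rw [mem_ball_zero_iff, norm_mul, Complex.norm_real, Real.norm_of_nonneg hr.1.le]
  nlinarith [hr.1, hr.2, norm_nonneg z]

lemma logMax_le_integral_dilate {f : ℂ → ℂ} (hf : DifferentiableOn ℂ f (Metric.ball 0 1)) {r : ℝ}
    (hr : r ∈ Set.Ioo (0 : ℝ) 1) {ε : ℝ} (hε : 0 < ε) :
    logMax ε ‖f 0‖ ≤ ∫ w : Circle, logMax ε ‖f (r * w)‖ ∂circleMeasure := by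
  simpa [diskPoisson, Circle.norm_coe] using
    logMax_le_integral_diskPoisson (diffContOnCl_dilate hf hr) hε (a := 0) (by simp)

lemma continuous_dilate_circle {f : ℂ → ℂ} (hf : DifferentiableOn ℂ f (Metric.ball 0 1)) {r : ℝ}
    (hr : r ∈ Set.Ioo (0 : ℝ) 1) : Continuous fun w : Circle => f (r * w) :=
  (diffContOnCl_dilate hf hr).continuousOn.comp_continuous (by fun_prop) fun w => by
      rw [closure_ball _ one_ne_zero]; simp [Circle.norm_coe]

/-- A sequence of radii increasing to `1`. -/
def radius (n : ℕ) : ℝ := 1 - 1 / (n + 2)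

lemma radius_mem (n : ℕ) : radius n ∈ Set.Ioo (0 : ℝ) 1 := by
  have h : (0 : ℝ) < n + 2 := by positivity
  have h1 : (1 : ℝ) / (n + 2) < 1 := by
    rw [div_lt_one h]; have : (0 : ℝ) ≤ n := n.cast_nonneg
    linarith
  have h2 : (0 : ℝ) < 1 / (n + 2) := by positivity
  constructor <;> simp only [radius] <;> linarith

lemma tendsto_radius : Tendsto radius atTop (𝓝[<] 1) := by
  refine tendsto_nhdsWithin_iff.mpr ⟨?_, .of_forall fun n => (radius_mem n).2⟩
  have h := tendsto_one_div_add_atTop_nhds_zero_nat (𝕜 := ℝ)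
  have h1 : Tendsto (fun n : ℕ => 1 - 1 / (((n + 1 : ℕ) : ℝ) + 1)) atTop (𝓝 (1 - 0)) :=
    tendsto_const_nhds.sub (h.comp (tendsto_add_atTop_nat 1))
  rw [sub_zero] at h1
  refine h1.congr fun n => ?_
  simp only [radius]; push_cast; ring

/-- Radial limits of bounded holomorphic functions that do not vanish at `0` are nonzero almost
everywhere. -/
lemma ae_not_tendsto_zero {f : ℂ → ℂ} (hf : DifferentiableOn ℂ f (Metric.ball 0 1))
    (h1 : ∀ z, ‖z‖ < 1 → ‖f z‖ ≤ 1) (h0 : f 0 ≠ 0) :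
    ∀ᵐ w : Circle ∂circleMeasure, ¬ Tendsto (fun r : ℝ => f (r * w)) (𝓝[<] 1) (𝓝 0) := by
  obtain ⟨g, hgm, hg⟩ := measurable_limit_of_tendsto_metrizable_ae (L := atTop)
    (f := fun n (w : Circle) => f (radius n * w)) (μ := circleMeasure)
    (fun n => (continuous_dilate_circle hf (radius_mem n)).measurable.aemeasurable) (by
      filter_upwards [ae_exists_radial_limit_of_bounded hf h1] with w ⟨c, hc⟩
      exact ⟨c, hc.comp tendsto_radius⟩)
  have hb : ∀ n (w : Circle), ‖f (radius n * w)‖ ≤ 1 := fun n w => h1 _ (by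
    simp [Circle.norm_coe, abs_of_pos (radius_mem n).1, (radius_mem n).2])
  set Z : Set Circle := {w | g w = 0} with hZdef
  have hZ : MeasurableSet Z := hgm (measurableSet_singleton 0)
  have hg1 : ∀ᵐ w ∂circleMeasure, ‖g w‖ ≤ 1 := by
    filter_upwards [hg] with w hw
    exact le_of_tendsto hw.norm (.of_forall fun n => hb n w)
  -- Jensen's inequality with log max(|f|, ε): the zero set of the limit contributes log ε times its
  -- measure, and the rest at most 0. Letting ε → 0 forces measure zero.
  have key : ∀ ε ∈ Set.Ioo (0 : ℝ) 1, Real.log ‖f 0‖ ≤ circleMeasure.real Z * Real.log ε := by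
    intro ε hε
    have hbd : ∀ x : ℝ, x ≤ 1 → ‖logMax ε x‖ ≤ -Real.log ε := fun x hx => by
      have h2 := log_le_logMax hε.1 x
      have h3 : logMax ε x ≤ 0 :=
        Real.log_nonpos (hε.1.le.trans (le_max_right _ _)) (max_le hx hε.2.le)
      rw [Real.norm_of_nonpos h3]; linarith
    have hlim : Tendsto (fun n => ∫ w : Circle, logMax ε ‖f (radius n * w)‖ ∂circleMeasure) atTop
        (𝓝 (∫ w, logMax ε ‖g w‖ ∂circleMeasure)) := by
      refine tendsto_integral_of_dominated_convergence (fun _ => -Real.log ε)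
        (fun n => ?_) (integrable_const _) (fun n => .of_forall fun w => hbd _ (hb n w)) ?_
      · exact ((continuous_logMax hε.1).comp
          (continuous_dilate_circle hf (radius_mem n)).norm).measurable.aestronglyMeasurable
      · filter_upwards [hg] with w hw
        exact ((continuous_logMax hε.1).tendsto _).comp hw.norm
    have h2 : Real.log ‖f 0‖ ≤ ∫ w, logMax ε ‖g w‖ ∂circleMeasure :=
      (Real.log_le_log (norm_pos_iff.mpr h0) (le_max_left _ _)).trans
        (ge_of_tendsto' hlim fun n => logMax_le_integral_dilate hf (radius_mem n) hε.1)
    refine h2.trans ?_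
    rw [← smul_eq_mul, ← integral_indicator_const _ hZ]
    refine integral_mono_ae ?_ ((integrable_const _).indicator hZ) ?_
    · refine Integrable.of_bound
        ((continuous_logMax hε.1).measurable.comp hgm.norm).aestronglyMeasurable (-Real.log ε) ?_
      filter_upwards [hg1] with w hw using hbd _ hw
    · filter_upwards [hg1] with w hw
      by_cases hwZ : w ∈ Z
      · rw [Set.indicator_of_mem hwZ]
        have : g w = 0 := hwZ
        simp [this, logMax, hε.1.le]
      · rw [Set.indicator_of_notMem hwZ]
        exact Real.log_nonpos (hε.1.le.trans (le_max_right _ _)) (max_le hw hε.2.le)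
  have hZ0 : circleMeasure Z = 0 := by
    by_contra hne
    have hpos : 0 < circleMeasure.real Z := by
      rw [Measure.real, ENNReal.toReal_pos_iff]
      exact ⟨pos_iff_ne_zero.mpr hne, measure_lt_top _ _⟩
    set t : ℝ := (|Real.log ‖f 0‖| + 1) / circleMeasure.real Z with ht
    have htp : 0 < t := by positivity
    have := key (Real.exp (-t)) ⟨Real.exp_pos _, by simpa using htp⟩
    rw [Real.log_exp, mul_neg, ht, mul_div_cancel₀ _ hpos.ne'] at this
    linarith [neg_abs_le (Real.log ‖f 0‖)]
  have hZ' : ∀ᵐ w ∂circleMeasure, w ∉ Z := measure_eq_zero_iff_ae_notMem.mp hZ0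
  filter_upwards [hg, hZ'] with w hw hwZ ht
  exact hwZ (tendsto_nhds_unique hw (ht.comp tendsto_radius))

/-- Montel's theorem on the unit disk, for functions bounded by `1`. -/
lemma exists_subseq_tendsto_of_bounded {h : ℕ → ℂ → ℂ}
    (hd : ∀ n, DifferentiableOn ℂ (h n) (Metric.ball 0 1))
    (hb : ∀ n z, ‖z‖ < 1 → ‖h n z‖ ≤ 1) :
    ∃ (φ : ℕ → ℕ) (g : ℂ → ℂ), StrictMono φ ∧ DifferentiableOn ℂ g (Metric.ball 0 1) ∧
      ∀ z, ‖z‖ < 1 → Tendsto (fun n => h (φ n) z) atTop (𝓝 (g z)) := by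
  -- Cauchy's estimates put the Taylor coefficients in a countable product of closed unit disks.
  -- This is sequentially compact, and coefficientwise limits pass to the sums by comparison with a
  -- geometric series.
  let a : ℕ → ℕ → ℂ := fun n k => (k.factorial : ℂ)⁻¹ * iteratedDeriv k (h n) 0
  have hsum : ∀ n z, ‖z‖ < 1 → HasSum (fun k => a n k * z ^ k) (h n z) := fun n z hz => by
    have := Complex.hasSum_taylorSeries_on_ball (hd n) (z := z) (by simpa using hz)
    refine this.congr_fun fun k => ?_
    simp only [a, sub_zero, smul_eq_mul]; ring
  have ha : ∀ n, a n ∈ Set.univ.pi fun _ : ℕ => Metric.closedBall (0 : ℂ) 1 := by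
    intro n k _
    rw [mem_closedBall_zero_iff]
    have hR : ∀ R ∈ Set.Ioo (0 : ℝ) 1, ‖a n k‖ ≤ 1 / R ^ k := by
      intro R hR
      have hsub : Metric.closedBall (0 : ℂ) R ⊆ Metric.ball 0 1 :=
        Metric.closedBall_subset_ball hR.2
      have := Complex.norm_iteratedDeriv_le_of_forall_mem_sphere_norm_le (C := 1) k hR.1
        (f := h n) (c := 0) (DifferentiableOn.diffContOnCl (by
          rw [closure_ball _ hR.1.ne']; exact (hd n).mono hsub)) (fun z hz => hb n z (by
          simpa using hsub (Metric.sphere_subset_closedBall hz)))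
      simp only [a, norm_mul, norm_inv, Complex.norm_natCast]
      have hk : (0 : ℝ) < k.factorial := by positivity
      rw [inv_mul_le_iff₀ hk]
      calc _ ≤ _ := this
        _ = _ := by ring
    have hlim : Tendsto (fun R : ℝ => 1 / R ^ k) (𝓝[<] 1) (𝓝 (1 / 1 ^ k)) := by
      have : ContinuousAt (fun R : ℝ => 1 / R ^ k) 1 := by
        fun_prop (disch := norm_num)
      exact this.tendsto.mono_left nhdsWithin_le_nhds
    rw [one_pow, div_one] at hlim
    refine ge_of_tendsto hlim ?_
    filter_upwards [Ioo_mem_nhdsLT (zero_lt_one' ℝ)] with R hR' using hR R hR'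
  obtain ⟨b, hbm, φ, hφ, hlim⟩ :=
    (isCompact_univ_pi fun _ : ℕ => isCompact_closedBall (0 : ℂ) 1).tendsto_subseq ha
  have hbk : ∀ k, ‖b k‖ ≤ 1 := fun k => by simpa using hbm k trivial
  refine ⟨φ, fun z => ∑' k, b k * z ^ k, hφ, ?_, fun z hz => ?_⟩
  · intro z hz
    rw [mem_ball_zero_iff] at hz
    obtain ⟨ρ, hzρ, hρ⟩ := exists_between hz
    have hρ0 : 0 ≤ ρ := (norm_nonneg z).trans hzρ.le
    have := Complex.differentiableOn_tsum_of_summable_norm (U := Metric.ball (0 : ℂ) ρ)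
      (F := fun k z => b k * z ^ k) (summable_geometric_of_lt_one hρ0 hρ)
      (fun k => by fun_prop) Metric.isOpen_ball (fun k w hw => by
        rw [mem_ball_zero_iff] at hw
        rw [norm_mul, norm_pow]
        calc ‖b k‖ * ‖w‖ ^ k ≤ 1 * ρ ^ k := by gcongr; exact hbk k
          _ = ρ ^ k := one_mul _)
    exact (this.differentiableAt (Metric.isOpen_ball.mem_nhds (by simpa using hzρ))).differentiableWithinAt
  · have h1 : (fun n => h (φ n) z) = fun n => ∑' k, a (φ n) k * z ^ k :=
      funext fun n => (hsum (φ n) z hz).tsum_eq.symm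
    rw [h1]
    refine tendsto_tsum_of_dominated_convergence
      (summable_geometric_of_lt_one (norm_nonneg z) hz) (fun k => ?_) (.of_forall fun n k => ?_)
    · exact ((tendsto_pi_nhds.mp hlim k)).mul_const _
    · have : ‖a (φ n) k‖ ≤ 1 := by simpa using ha (φ n) k trivial
      rw [norm_mul, norm_pow]
      calc _ ≤ 1 * ‖z‖ ^ k := by gcongr
        _ = _ := one_mul _

/-- Fatou's theorem for the Nevanlinna class. -/
lemma ae_exists_radial_limit {f : ℂ → ℂ} (hf : DifferentiableOn ℂ f (Metric.ball 0 1))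
    {r : ℕ → ℝ} (hr : ∀ n, r n ∈ Set.Ioo (0 : ℝ) 1) (hr1 : Tendsto r atTop (𝓝 1)) {C : ℝ}
    (hC : ∀ n, ∫ w : Circle, logMax 1 ‖f (r n * w)‖ ∂circleMeasure ≤ C) :
    ∀ᵐ w : Circle ∂circleMeasure, ∃ c, Tendsto (fun r : ℝ => f (r * w)) (𝓝[<] 1) (𝓝 c) := by
  have hu : ∀ n, Continuous fun w : Circle => logMax 1 ‖f (r n * w)‖ := fun n =>
    (continuous_logMax one_pos).comp (continuous_dilate_circle hf (hr n)).norm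
  -- Re Qₙ lies between log⁺|f(rₙ w)| and that plus 2. So exp(-Qₙ) and f(rₙ z) exp(-Qₙ) are bounded
  -- by 1, while the mean bound C keeps |exp(-Qₙ(0))| at least exp(-(C + 2)), which makes the Montel
  -- limit h nonzero at 0.
  choose Q hQ using fun n => exists_polynomial_re_approx ((hu n).add continuous_const)
    (u := fun w => logMax 1 ‖f (r n * w)‖ + 1) (one_pos)
  have hQ1 : ∀ n (w : Circle), logMax 1 ‖f (r n * w)‖ ≤ ((Q n).eval (w : ℂ)).re := fun n w => by
    linarith [(abs_lt.mp (hQ n w)).1]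
  have hQ2 : ∀ n (w : Circle), ((Q n).eval (w : ℂ)).re ≤ logMax 1 ‖f (r n * w)‖ + 2 := fun n w => by
    linarith [(abs_lt.mp (hQ n w)).2]
  have max_principle : ∀ g : ℂ → ℂ, DiffContOnCl ℂ g (Metric.ball 0 1) →
      (∀ w : Circle, ‖g w‖ ≤ 1) → ∀ z, ‖z‖ < 1 → ‖g z‖ ≤ 1 := by
    intro g hg hgw z hz
    refine Complex.norm_le_of_forall_mem_frontier_norm_le Metric.isBounded_ball hg ?_
      (subset_closure (by simpa using hz))
    intro x hx
    rw [frontier_ball _ one_ne_zero] at hx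
    exact hgw ⟨x, by simpa [Submonoid.unitSphere] using hx⟩
  have hh1 : ∀ n z, ‖z‖ < 1 → ‖Complex.exp (-(Q n).eval z)‖ ≤ 1 := by
    refine fun n => max_principle _ (Differentiable.diffContOnCl (by fun_prop)) fun w => ?_
    rw [Complex.norm_exp, Real.exp_le_one_iff, Complex.neg_re]
    have := log_le_logMax one_pos ‖f (r n * w)‖
    rw [Real.log_one] at this
    linarith [hQ1 n w]
  have hfh1 : ∀ n z, ‖z‖ < 1 → ‖f (r n * z) * Complex.exp (-(Q n).eval z)‖ ≤ 1 := by
    refine fun n => max_principle (fun z => f (r n * z) * Complex.exp (-(Q n).eval z))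
      ((diffContOnCl_dilate hf (hr n)).smul (Differentiable.diffContOnCl (by fun_prop))) fun w => ?_
    rw [norm_mul, Complex.norm_exp, Complex.neg_re]
    calc _ ≤ Real.exp (logMax 1 ‖f (r n * w)‖) * Real.exp (-((Q n).eval (w : ℂ)).re) := by
          gcongr; exact le_exp_logMax one_pos _
      _ ≤ 1 := by rw [← Real.exp_add, Real.exp_le_one_iff]; linarith [hQ1 n w]
  obtain ⟨φ, h, hφ, hhd, hlim⟩ := exists_subseq_tendsto_of_bounded
    (h := fun n z => Complex.exp (-(Q n).eval z))
    (fun n => Differentiable.differentiableOn (by fun_prop)) hh1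
  have hhb : ∀ z, ‖z‖ < 1 → ‖h z‖ ≤ 1 := fun z hz =>
    le_of_tendsto (hlim z hz).norm (.of_forall fun n => hh1 _ z hz)
  have hfhb : ∀ z, ‖z‖ < 1 → ‖f z * h z‖ ≤ 1 := fun z hz => by
    have h1 : Tendsto (fun n => f (r (φ n) * z)) atTop (𝓝 (f z)) := by
      have h2 : Tendsto (fun n => (r (φ n) : ℂ) * z) atTop (𝓝 (((1 : ℝ) : ℂ) * z)) :=
        ((Complex.continuous_ofReal.tendsto 1).comp (hr1.comp hφ.tendsto_atTop)).mul_const z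
      rw [Complex.ofReal_one, one_mul] at h2
      exact ((hf.differentiableAt (Metric.isOpen_ball.mem_nhds
        (by simpa using hz))).continuousAt.tendsto).comp h2
    exact le_of_tendsto (h1.mul (hlim z hz)).norm (.of_forall fun n => hfh1 _ z hz)
  have hh0 : h 0 ≠ 0 := by
    have h1 : ∀ n, Real.exp (-(C + 2)) ≤ ‖Complex.exp (-(Q (φ n)).eval 0)‖ := by
      intro n
      rw [Complex.norm_exp, Complex.neg_re, Real.exp_le_exp, neg_le_neg_iff]
      have h2 := integral_diskPoisson_smul (f := fun z => (Q (φ n)).eval z) (a := 0)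
        (Differentiable.diffContOnCl (by fun_prop)) (by simp)
      have h3 : Integrable (fun w : Circle => (Q (φ n)).eval (w : ℂ)) circleMeasure :=
        integrable_of_continuous_circle (by fun_prop)
      have h4 := integral_re h3
      simp only [diskPoisson, norm_zero, zero_sub, norm_neg, Circle.norm_coe] at h2
      norm_num at h2
      rw [← h2]
      change RCLike.re (∫ w : Circle, (Q (φ n)).eval (w : ℂ) ∂circleMeasure) ≤ C + 2
      rw [← h4]
      calc _ ≤ ∫ w : Circle, (logMax 1 ‖f (r (φ n) * w)‖ + 2) ∂circleMeasure :=
            integral_mono h3.re (integrable_of_continuous_circle ((hu (φ n)).add continuous_const))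
              fun w => hQ2 _ w
        _ ≤ C + 2 := by
            rw [integral_add (integrable_of_continuous_circle (hu (φ n))) (integrable_const _)]
            simpa using hC (φ n)
    have h2 := ge_of_tendsto' (hlim 0 (by simp)).norm h1
    intro h3
    rw [h3, norm_zero] at h2
    exact (Real.exp_pos _).not_ge h2
  filter_upwards [ae_exists_radial_limit_of_bounded (hf.mul hhd) hfhb,
    ae_exists_radial_limit_of_bounded hhd hhb, ae_not_tendsto_zero hhd hhb hh0]
    with w ⟨c₁, hc₁⟩ ⟨c₂, hc₂⟩ hne
  have hc0 : c₂ ≠ 0 := by rintro rfl; exact hne hc₂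
  refine ⟨c₁ / c₂, (hc₁.div hc₂ hc0).congr' ?_⟩
  filter_upwards [hc₂.eventually_ne hc0] with r hr
  simp [mul_div_cancel_right₀ _ hr]

/-! ### Holomorphic functions on open subsets of Banach spaces -/

section Banach

variable {X : Type*} [NormedAddCommGroup X] [NormedSpace ℂ X] {F : X → ℂ} {V : Set X}

/-- The Schwarz lemma on the complex line through y and z: a disk in the parameter of radius
(δ/2)/‖z - y‖ stays in the ball where F is bounded by C, and there F oscillates by at most 2C. -/
lemma HolomorphicOn.exists_local_lipschitz (hF : HolomorphicOn F V) (hV : IsOpen V) {x : X}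
    (hx : x ∈ V) :
    ∃ δ > 0, ∃ K : ℝ, ∀ y ∈ Metric.ball x δ, ∀ z ∈ Metric.ball x δ,
      ‖F z - F y‖ ≤ K * ‖z - y‖ := by
  obtain ⟨C, hC⟩ := hF.1 x hx
  rw [hV.nhdsWithin_eq hx] at hC
  obtain ⟨δ, hδ, hb⟩ := Metric.eventually_nhds_iff_ball.mp (hC.and (hV.mem_nhds hx))
  refine ⟨δ / 4, by positivity, 2 * C / (δ / 2), fun y hy z hz => ?_⟩
  rw [mem_ball_iff_norm] at hy hz
  rcases eq_or_ne z y with rfl | hne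
  · simp
  have hzy : 0 < ‖z - y‖ := norm_pos_iff.mpr (sub_ne_zero.mpr hne)
  have hzy' : ‖z - y‖ < δ / 2 := by
    have := norm_sub_le (z - x) (y - x)
    rw [sub_sub_sub_cancel_right] at this; linarith
  set R : ℝ := δ / 2 / ‖z - y‖ with hR
  have hRpos : 0 < R := by positivity
  have hin : ∀ t ∈ Metric.ball (0 : ℂ) R, y + t • (z - y) ∈ Metric.ball x δ := by
    intro t ht
    rw [mem_ball_zero_iff, hR, lt_div_iff₀ hzy] at ht
    rw [mem_ball_iff_norm]
    have := norm_add_le (y - x) (t • (z - y))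
    rw [norm_smul] at this
    rw [show y + t • (z - y) - x = (y - x) + t • (z - y) by abel]; linarith
  have hy' : y ∈ Metric.ball x δ := by rw [mem_ball_iff_norm]; linarith
  have hd : DifferentiableOn ℂ (fun t : ℂ => F (y + t • (z - y))) (Metric.ball 0 R) :=
    (hF.2 y (hb y hy').2 (z - y)).mono fun t ht => (hb _ (hin t ht)).2
  have := Complex.dist_le_div_mul_dist_of_mapsTo_ball (R₂ := 2 * C) hd (z := 1) (fun t ht => by
    rw [mem_closedBall_iff_norm]
    refine (norm_sub_le _ _).trans ?_
    have h1 := (hb _ (hin t ht)).1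
    have h2 := (hb _ hy').1
    simp only [zero_smul, add_zero]; linarith) (by
    rw [mem_ball_zero_iff, norm_one, hR, one_lt_div hzy]; exact hzy')
  simp only [one_smul, add_sub_cancel, zero_smul, add_zero, dist_eq_norm, sub_zero, norm_one,
    mul_one] at this
  refine this.trans_eq ?_
  rw [hR]; field_simp

lemma HolomorphicOn.continuousAt (hF : HolomorphicOn F V) (hV : IsOpen V) {x : X} (hx : x ∈ V) :
    ContinuousAt F x := by
  obtain ⟨δ, hδ, K, hK⟩ := hF.exists_local_lipschitz hV hx
  rw [ContinuousAt, tendsto_iff_norm_sub_tendsto_zero]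
  have h1 : Tendsto (fun z => K * ‖z - x‖) (𝓝 x) (𝓝 (K * ‖x - x‖)) :=
    Continuous.tendsto (by fun_prop) x
  rw [sub_self, norm_zero, mul_zero] at h1
  refine squeeze_zero' (.of_forall fun _ => norm_nonneg _) ?_ h1
  filter_upwards [Metric.ball_mem_nhds x hδ] with z hz
  exact hK x (Metric.mem_ball_self hδ) z hz

/-- The curve γ is replaced by its tangent line, on which F is differentiable by definition; the
local Lipschitz bound makes the error o(t - t₀). Fréchet differentiability of F is not needed. -/
lemma HolomorphicOn.differentiableAt_comp (hF : HolomorphicOn F V) (hV : IsOpen V)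
    {γ : ℂ → X} {t₀ : ℂ} (hγ : DifferentiableAt ℂ γ t₀) (hx : γ t₀ ∈ V) :
    DifferentiableAt ℂ (fun t => F (γ t)) t₀ := by
  obtain ⟨δ, hδ, K, hK⟩ := hF.exists_local_lipschitz hV hx
  set γ' := deriv γ t₀ with hγ'
  set ℓ : ℂ → X := fun t => γ t₀ + (t - t₀) • γ' with hℓ
  have hℓc : Continuous ℓ := by simp only [hℓ]; fun_prop
  have hℓ0 : ℓ t₀ = γ t₀ := by simp [hℓ]
  have hline : DifferentiableAt ℂ (fun t => F (ℓ t)) t₀ := by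
    have h1 := hF.2 _ hx γ'
    have h2 : DifferentiableAt ℂ (fun z : ℂ => F (γ t₀ + z • γ')) (t₀ - t₀) := by
      refine h1.differentiableAt ((hV.preimage (by fun_prop)).mem_nhds ?_)
      simpa using hx
    exact DifferentiableAt.comp (g := fun z : ℂ => F (γ t₀ + z • γ')) (f := fun t => t - t₀) t₀ h2
      (by fun_prop)
  have hlo : (fun t => F (γ t) - F (ℓ t)) =o[𝓝 t₀] fun t => t - t₀ := by
    have h1 : (fun t => F (γ t) - F (ℓ t)) =O[𝓝 t₀] fun t => γ t - ℓ t := by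
      refine Asymptotics.IsBigO.of_bound K ?_
      filter_upwards [hγ.continuousAt.preimage_mem_nhds (Metric.ball_mem_nhds _ hδ),
        hℓc.continuousAt.preimage_mem_nhds (by
          rw [hℓ0]; exact Metric.ball_mem_nhds _ hδ)] with t ht1 ht2
      exact hK _ ht2 _ ht1
    refine h1.trans_isLittleO ?_
    refine (hasDerivAt_iff_isLittleO.mp hγ.hasDerivAt).congr_left fun t => ?_
    simp only [hℓ]; abel
  have h3 : HasDerivAt (fun t => F (γ t) - F (ℓ t)) 0 t₀ := by
    rw [hasDerivAt_iff_isLittleO]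
    simpa [hℓ0] using hlo
  have := h3.differentiableAt.add hline
  refine this.congr_of_eventuallyEq (.of_forall fun t => ?_)
  simp

end Banach

/-! ### The polydisks -/

lemma mem_polydiskTwo {ζ : ℕ → ℂ} :
    ζ ∈ polydiskTwo ↔ (Summable fun n => ‖ζ n‖ ^ 2) ∧ ∀ n, ‖ζ n‖ < 1 := by
  have h : (0 : ℝ) < (2 : ℝ≥0∞).toReal := by norm_num
  simp [polydiskTwo, memℓp_gen_iff h]

lemma mem_polydiskOne {ζ : ℕ → ℂ} :
    ζ ∈ polydiskOne ↔ (Summable fun n => ‖ζ n‖) ∧ ∀ n, ‖ζ n‖ < 1 := by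
  have h : (0 : ℝ) < (1 : ℝ≥0∞).toReal := by norm_num
  simp [polydiskOne, memℓp_gen_iff h]

lemma summable_sq_of_le {a b : ℕ → ℝ} (ha : ∀ n, 0 ≤ a n) (hab : ∀ n, a n ≤ b n)
    (hb : Summable fun n => b n ^ 2) : Summable fun n => a n ^ 2 :=
  hb.of_nonneg_of_le (fun _ => sq_nonneg _) fun n => pow_le_pow_left₀ (ha n) (hab n) 2

lemma polydiskOne_subset : polydiskOne ⊆ polydiskTwo := by
  intro ζ hζ
  rw [mem_polydiskOne] at hζ
  rw [mem_polydiskTwo]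
  refine ⟨hζ.1.of_nonneg_of_le (fun n => sq_nonneg _) fun n => ?_, hζ.2⟩
  nlinarith [norm_nonneg (ζ n), hζ.2 n]

/-- Coordinates of an ℓ² sequence tend to 0, so their moduli are bounded by one q < 1 and the ball
of radius 1 - q fits. -/
lemma isOpen_polydiskTwo :
    IsOpen {x : lp (fun _ : ℕ => ℂ) 2 | (x : ℕ → ℂ) ∈ polydiskTwo} := by
  rw [Metric.isOpen_iff]
  intro x hx
  have hx' := mem_polydiskTwo.mp hx
  have hlim : Tendsto (fun n => ‖x n‖ ^ 2) atTop (𝓝 0) := hx'.1.tendsto_atTop_zero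
  obtain ⟨N, hN⟩ := eventually_atTop.mp (hlim.eventually_lt_const (show (0 : ℝ) < 1 / 4 by norm_num))
  have hex : ∃ q < (1 : ℝ), ∀ n, ‖x n‖ ≤ q := by
    refine ⟨max (1 / 2) ((Finset.range (N + 1)).sup' ⟨0, by simp⟩ fun n => ‖x n‖),
      max_lt (by norm_num) ((Finset.sup'_lt_iff _).mpr fun n _ => hx'.2 n), fun n => ?_⟩
    rcases lt_or_ge n (N + 1) with h | h
    · exact le_max_of_le_right (Finset.le_sup' (fun n => ‖x n‖) (Finset.mem_range.mpr h))
    · refine le_max_of_le_left ?_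
      have := hN n (by omega)
      nlinarith [norm_nonneg (x n)]
  obtain ⟨q, hq, hxq⟩ := hex
  refine ⟨1 - q, by linarith, fun y hy => ⟨lp.memℓp y, fun n => ?_⟩⟩
  rw [mem_ball_iff_norm] at hy
  have h1 := lp.norm_apply_le_norm two_ne_zero (y - x) n
  have h2 := norm_le_norm_add_norm_sub' (y n) (x n)
  have h3 : (y - x) n = y n - x n := rfl
  rw [h3] at h1
  linarith [hxq n]

/-- Dominated convergence for holomorphic functions on `𝔻₂^∞`. -/
lemma HolomorphicOnPolydiskTwo.tendsto {F : (ℕ → ℂ) → ℂ} (hF : HolomorphicOnPolydiskTwo F)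
    {ι : Type*} {l : Filter ι} {x : ι → ℕ → ℂ} {y : ℕ → ℂ} {b : ℕ → ℝ}
    (hb : Summable fun n => b n ^ 2) (hx : ∀ᶠ i in l, ∀ n, ‖x i n‖ ≤ b n ∧ ‖x i n‖ < 1)
    (hy : ∀ n, ‖y n‖ ≤ b n ∧ ‖y n‖ < 1) (hlim : ∀ n, Tendsto (fun i => x i n) l (𝓝 (y n))) :
    Tendsto (fun i => F (x i)) l (𝓝 (F y)) := by
  have hmem : ∀ u : ℕ → ℂ, (∀ n, ‖u n‖ ≤ b n ∧ ‖u n‖ < 1) → u ∈ polydiskTwo := fun u hu =>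
    mem_polydiskTwo.mpr ⟨summable_sq_of_le (fun _ => norm_nonneg _) (fun n => (hu n).1) hb,
      fun n => (hu n).2⟩
  have hyV := hmem y hy
  have hc := HolomorphicOn.continuousAt hF isOpen_polydiskTwo (x := ⟨y, hyV.1⟩) hyV
  have hS : Tendsto (fun i => ∑' n, ‖x i n - y n‖ ^ 2) l (𝓝 (∑' _ : ℕ, 0)) := by
    refine tendsto_tsum_of_dominated_convergence (hb.mul_left 4) (fun n => ?_) ?_
    · have := (((hlim n).sub_const (y n)).norm).pow 2
      simpa using this
    · filter_upwards [hx] with i hi n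
      rw [Real.norm_of_nonneg (by positivity)]
      have h1 := norm_sub_le (x i n) (y n)
      have h2 : ‖x i n - y n‖ ≤ 2 * b n := by linarith [(hi n).1, (hy n).1]
      calc _ ≤ (2 * b n) ^ 2 := by gcongr
        _ = _ := by ring
  rw [tsum_zero] at hS
  rw [Metric.tendsto_nhds]
  intro ε hε
  obtain ⟨δ, hδ, h⟩ := Metric.continuousAt_iff.mp hc ε hε
  filter_upwards [hx, hS.eventually_lt_const (show 0 < δ ^ 2 by positivity)] with i hi hSi
  refine h (x := ⟨x i, (hmem _ hi).1⟩) ?_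
  rw [dist_eq_norm]
  refine lt_of_pow_lt_pow_left₀ 2 hδ.le ?_
  have hn := lp.norm_rpow_eq_tsum (p := 2) (by norm_num)
    ((⟨x i, (hmem _ hi).1⟩ : lp (fun _ : ℕ => ℂ) 2) - ⟨y, hyV.1⟩)
  norm_num at hn
  rw [hn]
  exact hSi

lemma HolomorphicOnPolydiskTwo.differentiableAt_comp {F : (ℕ → ℂ) → ℂ}
    (hF : HolomorphicOnPolydiskTwo F) {γ : ℂ → lp (fun _ : ℕ => ℂ) 2} {t : ℂ}
    (hγ : DifferentiableAt ℂ γ t) (ht : (γ t : ℕ → ℂ) ∈ polydiskTwo) :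
    DifferentiableAt ℂ (fun t => F (γ t)) t :=
  HolomorphicOn.differentiableAt_comp (F := fun x : lp (fun _ : ℕ => ℂ) 2 => F x) hF
    isOpen_polydiskTwo hγ ht

lemma summable_pow_succ {r : ℝ} (h0 : 0 ≤ r) (h1 : r < 1) : Summable fun n : ℕ => r ^ (n + 1) :=
  (summable_nat_add_iff 1).mpr (summable_geometric_of_lt_one h0 h1)

lemma summable_pow_succ_sq {r : ℝ} (h0 : 0 ≤ r) (h1 : r < 1) :
    Summable fun n : ℕ => (r ^ (n + 1)) ^ 2 := by
  refine (summable_pow_succ h0 h1).of_nonneg_of_le (fun n => by positivity) fun n => ?_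
  have h2 : r ^ (n + 1) ≤ 1 := pow_le_one₀ h0 h1.le
  have h3 : 0 ≤ r ^ (n + 1) := by positivity
  nlinarith

/-- The curve z ↦ (zⁿ⁺¹ wₙ) is holomorphic into ℓ² as a normally convergent series of coordinate
vectors. Its values at z = ru are the dilations at a rotated point of the torus. -/
lemma HolomorphicOnPolydiskTwo.differentiableOn_slice {F : (ℕ → ℂ) → ℂ}
    (hF : HolomorphicOnPolydiskTwo F) (w : ℕ → Circle) :
    DifferentiableOn ℂ (fun z : ℂ => F fun n => z ^ (n + 1) * (w n : ℂ)) (Metric.ball 0 1) := by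
  intro z hz
  rw [mem_ball_zero_iff] at hz
  obtain ⟨ρ, hzρ, hρ⟩ := exists_between hz
  have hρ0 : 0 ≤ ρ := (norm_nonneg z).trans hzρ.le
  set γ : ℂ → lp (fun _ : ℕ => ℂ) 2 :=
    fun z => ∑' n, (z ^ (n + 1) * (w n : ℂ)) • lp.single 2 n (1 : ℂ) with hγ
  have hnorm : ∀ (z : ℂ) n, ‖z ^ (n + 1) * (w n : ℂ)‖ = ‖z‖ ^ (n + 1) := fun z n => by
    rw [norm_mul, norm_pow, Circle.norm_coe, mul_one]
  have hmem : ∀ z : ℂ, ‖z‖ < 1 → (fun n => z ^ (n + 1) * (w n : ℂ)) ∈ polydiskTwo := fun z hz => by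
    rw [mem_polydiskTwo]
    simp_rw [hnorm]
    exact ⟨summable_pow_succ_sq (norm_nonneg z) hz,
      fun n => pow_lt_one₀ (norm_nonneg z) hz n.succ_ne_zero⟩
  have hval : ∀ z : ℂ, ‖z‖ < 1 → (γ z : ℕ → ℂ) = fun n => z ^ (n + 1) * (w n : ℂ) := fun z hz => by
    have h1 := lp.hasSum_single (p := 2) (by norm_num)
      (⟨_, (hmem z hz).1⟩ : lp (fun _ : ℕ => ℂ) 2)
    have h2 : γ z = ⟨_, (hmem z hz).1⟩ := by
      rw [hγ, ← h1.tsum_eq]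
      refine tsum_congr fun n => ?_
      rw [← lp.single_smul, smul_eq_mul, mul_one]
    rw [h2]
  have hd : DifferentiableOn ℂ γ (Metric.ball 0 ρ) := by
    refine Complex.differentiableOn_tsum_of_summable_norm (summable_pow_succ hρ0 hρ)
      (fun n => by fun_prop) Metric.isOpen_ball fun n z hz => ?_
    rw [mem_ball_zero_iff] at hz
    rw [norm_smul, hnorm, lp.norm_single (by norm_num), norm_one, mul_one]
    gcongr
  have hγz := hd.differentiableAt (Metric.isOpen_ball.mem_nhds (by simpa using hzρ))
  have := hF.differentiableAt_comp hγz (by rw [hval z hz]; exact hmem z hz)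
  refine (this.congr_of_eventuallyEq ?_).differentiableWithinAt
  filter_upwards [Metric.isOpen_ball.mem_nhds (mem_ball_zero_iff.mpr hz)] with x hx
  rw [hval x (mem_ball_zero_iff.mp hx)]

lemma update_mem_polydiskOne {ζ : ℕ → ℂ} (hζ : ζ ∈ polydiskOne) (k : ℕ) {z : ℂ} (hz : ‖z‖ < 1) :
    Function.update ζ k z ∈ polydiskOne := by
  rw [mem_polydiskOne] at hζ ⊢
  refine ⟨?_, fun n => ?_⟩
  · refine (hζ.1.update k ‖z‖).congr fun n => ?_
    rcases eq_or_ne n k with rfl | h <;> simp [*]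
  · rcases eq_or_ne n k with rfl | h
    · simpa using hz
    · simpa [h] using hζ.2 n

lemma HolomorphicOnPolydiskTwo.differentiableOn_line {F : (ℕ → ℂ) → ℂ}
    (hF : HolomorphicOnPolydiskTwo F) {x v : ℕ → ℂ} (hx : Memℓp x 2) (hv : Memℓp v 2) {U : Set ℂ}
    (hU : ∀ z ∈ U, (fun n => x n + z * v n) ∈ polydiskTwo) :
    DifferentiableOn ℂ (fun z : ℂ => F fun n => x n + z * v n) U := by
  intro z hz
  have hγ : DifferentiableAt ℂ
      (fun z : ℂ => (⟨x, hx⟩ : lp (fun _ : ℕ => ℂ) 2) + z • (⟨v, hv⟩ : lp (fun _ : ℕ => ℂ) 2)) z :=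
    (differentiableAt_id.smul_const _).const_add _
  exact (hF.differentiableAt_comp hγ (hU z hz)).differentiableWithinAt

lemma update_eq_add_mul (ζ : ℕ → ℂ) (k : ℕ) (z : ℂ) :
    Function.update ζ k z = fun n => Function.update ζ k 0 n + z * (Pi.single k 1 : ℕ → ℂ) n := by
  ext n
  rcases eq_or_ne n k with rfl | h
  · rw [Function.update_self, Function.update_self, Pi.single_eq_same, zero_add, mul_one]
  · rw [Function.update_of_ne h, Function.update_of_ne h, Pi.single_eq_of_ne h, mul_zero, add_zero]

lemma HolomorphicOnPolydiskTwo.differentiableOn_update {F : (ℕ → ℂ) → ℂ}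
    (hF : HolomorphicOnPolydiskTwo F) {ζ : ℕ → ℂ} (hζ : ζ ∈ polydiskOne) (k : ℕ) :
    DifferentiableOn ℂ (fun z : ℂ => F (Function.update ζ k z)) (Metric.ball 0 1) := by
  have hmem : ∀ z ∈ Metric.ball (0 : ℂ) 1, Function.update ζ k z ∈ polydiskTwo := fun z hz =>
    polydiskOne_subset (update_mem_polydiskOne hζ k (by simpa using hz))
  have h0 := hmem 0 (by simp)
  have hm0 : Memℓp (Function.update ζ k 0) 2 := h0.1
  have hs : Memℓp (Pi.single k 1 : ℕ → ℂ) 2 := by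
    refine memℓp_gen (summable_of_ne_finset_zero (s := {k}) fun n hn => ?_)
    rw [Pi.single_eq_of_ne (by simpa using hn)]
    norm_num
  have key := hF.differentiableOn_line (U := Metric.ball 0 1) hm0 hs fun z hz =>
    (update_eq_add_mul ζ k z) ▸ hmem z hz
  have heq : (fun z : ℂ => F (Function.update ζ k z)) = fun z : ℂ =>
      F fun n => Function.update ζ k 0 n + z * (Pi.single k 1 : ℕ → ℂ) n :=
    funext fun z => congrArg F (update_eq_add_mul ζ k z)
  rw [heq]
  exact key

/-! ### The infinite torus -/

instance instBorelSpaceTorus : BorelSpace (ℕ → Circle) := Pi.borelSpace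

/-- Resampling one coordinate independently does not change the product law. This yields Fubini in a
single coordinate without splitting the infinite product. -/
lemma measurePreserving_update (k : ℕ) :
    MeasurePreserving (fun x : (ℕ → Circle) × Circle => Function.update x.1 k x.2)
      (torusMeasure.prod circleMeasure) torusMeasure := by
  have hm : Measurable fun x : (ℕ → Circle) × Circle => Function.update x.1 k x.2 := by
    rw [measurable_pi_iff]
    intro n
    rcases eq_or_ne n k with rfl | h
    · simpa using measurable_snd
    · simpa [h, Function.comp_def] using (measurable_pi_apply n).comp measurable_fst
  refine ⟨hm, Measure.eq_infinitePi _ fun s t ht => ?_⟩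
  rw [Measure.map_apply hm (.pi s.countable_toSet fun _ _ => ht _)]
  by_cases hk : k ∈ s
  · have hpre : (fun x : (ℕ → Circle) × Circle => Function.update x.1 k x.2) ⁻¹' (s : Set ℕ).pi t
        = ((s.erase k : Finset ℕ) : Set ℕ).pi t ×ˢ t k := by
      ext ⟨w, u⟩
      simp only [Set.mem_preimage, Set.mem_pi, Finset.mem_coe, Set.mem_prod, Finset.mem_erase]
      constructor
      · intro h
        refine ⟨fun i hi => ?_, by simpa using h k hk⟩
        simpa [hi.1] using h i hi.2
      · rintro ⟨h1, h2⟩ i hi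
        rcases eq_or_ne i k with rfl | h
        · simpa using h2
        · simpa [h] using h1 i ⟨h, hi⟩
    rw [hpre, Measure.prod_prod, torusMeasure, Measure.infinitePi_pi _ fun i _ => ht i,
      Finset.prod_erase_mul _ _ hk]
  · have hpre : (fun x : (ℕ → Circle) × Circle => Function.update x.1 k x.2) ⁻¹' (s : Set ℕ).pi t
        = (s : Set ℕ).pi t ×ˢ Set.univ := by
      ext ⟨w, u⟩
      simp only [Set.mem_preimage, Set.mem_pi, Finset.mem_coe, Set.mem_prod, Set.mem_univ, and_true]
      refine forall₂_congr fun i hi => ?_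
      have : i ≠ k := by rintro rfl; exact hk hi
      simp [this]
    rw [hpre, Measure.prod_prod, measure_univ, mul_one, torusMeasure,
      Measure.infinitePi_pi _ fun i _ => ht i]

lemma integral_torus_update {G : (ℕ → Circle) → ℝ} (hG : Integrable G torusMeasure) (k : ℕ) :
    ∫ w, G w ∂torusMeasure
      = ∫ w, ∫ t, G (Function.update w k t) ∂circleMeasure ∂torusMeasure := by
  have hmp := measurePreserving_update k
  have hi : Integrable (fun x : (ℕ → Circle) × Circle => G (Function.update x.1 k x.2))
      (torusMeasure.prod circleMeasure) := hmp.integrable_comp_of_integrable hG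
  have hint := integral_map hmp.measurable.aemeasurable (f := G)
    (by rw [hmp.map_eq]; exact hG.aestronglyMeasurable)
  rw [hmp.map_eq] at hint
  rw [hint, ← integral_prod (fun x : (ℕ → Circle) × Circle => G (Function.update x.1 k x.2)) hi]

lemma integrable_integral_torus_update {G : (ℕ → Circle) → ℝ} (hG : Integrable G torusMeasure)
    (k : ℕ) : Integrable (fun w => ∫ t, G (Function.update w k t) ∂circleMeasure) torusMeasure :=
  ((measurePreserving_update k).integrable_comp_of_integrable hG).integral_prod_left

lemma measurePreserving_torus_mul (u : ℕ → Circle) :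
    MeasurePreserving (fun (w : ℕ → Circle) n => u n * w n) torusMeasure torusMeasure := by
  have hm : ∀ n, Measurable fun w : Circle => u n * w := fun n =>
    (measurePreserving_mul_circle (u n)).measurable
  refine ⟨measurable_pi_iff.mpr fun n => (hm n).comp (measurable_pi_apply n), ?_⟩
  rw [torusMeasure, Measure.infinitePi_map_pi _ hm]
  congr with n : 1
  exact (measurePreserving_mul_circle (u n)).map_eq

/-! ### Radial limits on the infinite torus -/

section

variable {F : (ℕ → ℂ) → ℂ}

lemma HolomorphicOnPolydiskTwo.continuous_comp (hF : HolomorphicOnPolydiskTwo F)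
    {Y : Type*} [TopologicalSpace Y] {x : Y → ℕ → ℂ} (hx : ∀ n, Continuous fun y => x y n) {r : ℝ}
    (hr : r ∈ Set.Ioo (0 : ℝ) 1) (hb : ∀ y n, ‖x y n‖ ≤ r ^ (n + 1)) :
    Continuous fun y => F (x y) := by
  have h1 : ∀ y n, ‖x y n‖ ≤ r ^ (n + 1) ∧ ‖x y n‖ < 1 := fun y n =>
    ⟨hb y n, (hb y n).trans_lt (pow_lt_one₀ hr.1.le hr.2 n.succ_ne_zero)⟩
  exact continuous_iff_continuousAt.mpr fun y₀ => hF.tendsto (summable_pow_succ_sq hr.1.le hr.2)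
    (.of_forall h1) (h1 y₀) fun n => (hx n).continuousAt

lemma norm_dilate_arg {r : ℝ} (hr : r ∈ Set.Ioo (0 : ℝ) 1) (w : ℕ → Circle) (n : ℕ) :
    ‖(r : ℂ) ^ (n + 1) * (w n : ℂ)‖ = r ^ (n + 1) := by
  rw [norm_mul, norm_pow, Circle.norm_coe, mul_one, Complex.norm_real, Real.norm_of_nonneg hr.1.le]

lemma dilate_arg_mem {r : ℝ} (hr : r ∈ Set.Ioo (0 : ℝ) 1) (w : ℕ → Circle) :
    (fun n => (r : ℂ) ^ (n + 1) * (w n : ℂ)) ∈ polydiskTwo := by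
  rw [mem_polydiskTwo]
  simp_rw [norm_dilate_arg hr]
  exact ⟨summable_pow_succ_sq hr.1.le hr.2, fun n => pow_lt_one₀ hr.1.le hr.2 n.succ_ne_zero⟩

lemma HolomorphicOnPolydiskTwo.continuous_dilate (hF : HolomorphicOnPolydiskTwo F) {r : ℝ}
    (hr : r ∈ Set.Ioo (0 : ℝ) 1) : Continuous (dilate F r) :=
  hF.continuous_comp (fun n => by fun_prop) hr fun w n => (norm_dilate_arg hr w n).le

/-- All p are reduced to one finite exponent; a bounded F is treated with exponent 1. -/
lemma exists_lintegral_bound {p : ℝ≥0∞} (hp : 0 < p) (hF : MemHardy p F) :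
    ∃ q > (0 : ℝ), ∃ C < ∞, ∀ r ∈ Set.Ioo (0 : ℝ) 1,
      ∫⁻ w, ‖dilate F r w‖ₑ ^ q ∂torusMeasure ≤ C := by
  rcases eq_or_ne p ∞ with rfl | hp'
  · obtain ⟨C, hC⟩ := hF.2.2 rfl
    refine ⟨1, one_pos, ENNReal.ofReal C, ENNReal.ofReal_lt_top, fun r hr => ?_⟩
    calc ∫⁻ w, ‖dilate F r w‖ₑ ^ (1 : ℝ) ∂torusMeasure
        ≤ ∫⁻ _, ENNReal.ofReal C ∂torusMeasure := by
          refine lintegral_mono fun w => ?_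
          rw [ENNReal.rpow_one, ← ofReal_norm]
          exact ENNReal.ofReal_le_ofReal (hC _ (dilate_arg_mem hr w))
      _ = _ := by simp
  · exact ⟨p.toReal, ENNReal.toReal_pos hp.ne' hp', _, hF.2.1 hp', fun r hr =>
      le_iSup₂_of_le r hr le_rfl⟩

lemma logMax_one_le_rpow {q x : ℝ} (hq : 0 < q) (hx : 0 ≤ x) : logMax 1 x ≤ x ^ q / q := by
  rw [logMax]
  rcases le_total x 1 with h | h
  · rw [max_eq_right h, Real.log_one]; positivity
  · rw [max_eq_left h]
    exact Real.log_le_rpow_div hx hq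

/-- The rotation of the infinite torus associated with the dilations. -/
def rotate (u : Circle) (w : ℕ → Circle) : ℕ → Circle := fun n => u ^ (n + 1) * w n

lemma continuous_rotate : Continuous fun x : (ℕ → Circle) × Circle => rotate x.2 x.1 := by
  unfold rotate; fun_prop

lemma continuous_rotate_left (w : ℕ → Circle) : Continuous fun u : Circle => rotate u w := by
  unfold rotate; fun_prop

lemma dilate_rotate (F : (ℕ → ℂ) → ℂ) (r : ℝ) (u : Circle) (w : ℕ → Circle) :
    dilate F r (rotate u w) = F fun n => ((r : ℂ) * u) ^ (n + 1) * (w n : ℂ) := by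
  unfold dilate rotate
  congr 1
  ext n
  push_cast
  ring

lemma HolomorphicOnPolydiskTwo.measurableSet_exists_limit (hF : HolomorphicOnPolydiskTwo F) :
    MeasurableSet {w | ∃ c, Tendsto (fun r => dilate F r w) (𝓝[<] 1) (𝓝 c)} := by
  refine measurableSet_exists_tendsto_one (fun r hr => (hF.continuous_dilate hr).measurable)
    fun w => ?_
  refine (hF.differentiableOn_slice w).continuousOn.comp (f := fun r : ℝ => (r : ℂ))
    (by fun_prop) fun r hr => ?_
  simp [abs_of_pos hr.1, hr.2]

/-- Averaging over the measure-preserving rotations `rotate u` turns the Hardy bound into a bound on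
circle means of slices. Almost every slice therefore satisfies the hypotheses of
`ae_exists_radial_limit`. -/
lemma HolomorphicOnPolydiskTwo.ae_exists_limit (hF : HolomorphicOnPolydiskTwo F)
    {q : ℝ} (hq : 0 < q) {C : ℝ≥0∞} (hC : C < ∞)
    (hb : ∀ r ∈ Set.Ioo (0 : ℝ) 1, ∫⁻ w, ‖dilate F r w‖ₑ ^ q ∂torusMeasure ≤ C) :
    ∀ᵐ w ∂torusMeasure, ∃ c, Tendsto (fun r => dilate F r w) (𝓝[<] 1) (𝓝 c) := by
  set A : ℕ → (ℕ → Circle) → ℝ≥0∞ := fun n w =>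
    ∫⁻ u, ‖dilate F (radius n) (rotate u w)‖ₑ ^ q ∂circleMeasure with hA
  have hcont : ∀ n, Continuous fun x : (ℕ → Circle) × Circle =>
      dilate F (radius n) (rotate x.2 x.1) := fun n =>
    (hF.continuous_dilate (radius_mem n)).comp continuous_rotate
  have hmeas : ∀ n, Measurable fun x : (ℕ → Circle) × Circle =>
      ‖dilate F (radius n) (rotate x.2 x.1)‖ₑ ^ q := fun n =>
    (hcont n).measurable.enorm.pow_const q
  have hrot : ∀ u, MeasurePreserving (rotate u) torusMeasure torusMeasure := fun u =>
    measurePreserving_torus_mul fun n => u ^ (n + 1)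
  have hAint : ∀ n, ∫⁻ w, A n w ∂torusMeasure ≤ C := by
    intro n
    simp only [hA]
    rw [lintegral_lintegral_swap (hmeas n).aemeasurable]
    calc _ = ∫⁻ _ : Circle, ∫⁻ w, ‖dilate F (radius n) w‖ₑ ^ q ∂torusMeasure ∂circleMeasure := by
          refine lintegral_congr fun u => ?_
          exact (hrot u).lintegral_comp (f := fun w => ‖dilate F (radius n) w‖ₑ ^ q)
            ((hF.continuous_dilate (radius_mem n)).measurable.enorm.pow_const q)
      _ ≤ ∫⁻ _ : Circle, C ∂circleMeasure := lintegral_mono fun _ => hb _ (radius_mem n)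
      _ = C := by simp
  have hAm : ∀ n, Measurable (A n) := fun n => (hmeas n).lintegral_prod_right'
  -- Fatou's lemma only gives a finite lower limit of the circle means for each w, hence the passage
  -- to a subsequence of radii depending on w.
  have hlim : ∀ᵐ w ∂torusMeasure, liminf (fun n => A n w) atTop < ∞ := by
    refine ae_lt_top (.liminf hAm) (ne_top_of_le_ne_top hC.ne ?_)
    refine (lintegral_liminf_le hAm).trans ?_
    exact liminf_le_of_le (by isBoundedDefault) fun b hb =>
      let ⟨n, hn⟩ := hb.exists; hn.trans (hAint n)
  have hrad : ∀ᵐ w ∂torusMeasure, ∀ᵐ u ∂circleMeasure,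
      rotate u w ∈ {w | ∃ c, Tendsto (fun r => dilate F r w) (𝓝[<] 1) (𝓝 c)} := by
    filter_upwards [hlim] with w hw
    obtain ⟨K, hK1, hK2⟩ := ENNReal.lt_iff_exists_nnreal_btwn.mp hw
    obtain ⟨φ, hφ, hφK⟩ := extraction_of_frequently_atTop
      (frequently_lt_of_liminf_lt (by isBoundedDefault) hK1)
    have hf := hF.differentiableOn_slice w
    have := ae_exists_radial_limit hf (fun n => radius_mem (φ n))
      ((tendsto_nhdsWithin_iff.mp tendsto_radius).1.comp hφ.tendsto_atTop) (C := (K : ℝ) / q) ?_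
    · filter_upwards [this] with u hu
      simpa only [Set.mem_ofPred_eq, dilate_rotate] using hu
    · intro n
      have hc : Continuous fun u : Circle => dilate F (radius (φ n)) (rotate u w) :=
        (hF.continuous_dilate (radius_mem (φ n))).comp (continuous_rotate_left w)
      have hint : Integrable (fun u : Circle => ‖dilate F (radius (φ n)) (rotate u w)‖ ^ q / q)
          circleMeasure := by
        refine integrable_of_continuous_circle (.div_const ?_ q)
        exact hc.norm.rpow_const fun _ => Or.inr hq.le
      simp_rw [← dilate_rotate]
      calc _ ≤ ∫ u, ‖dilate F (radius (φ n)) (rotate u w)‖ ^ q / q ∂circleMeasure :=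
            integral_mono (integrable_of_continuous_circle
              ((continuous_logMax one_pos).comp hc.norm)) hint
              fun u => logMax_one_le_rpow hq (norm_nonneg _)
        _ = (∫ u, ‖dilate F (radius (φ n)) (rotate u w)‖ ^ q ∂circleMeasure) / q :=
            integral_div _ _
        _ ≤ K / q := by
            gcongr
            rw [integral_eq_lintegral_of_nonneg_ae (.of_forall fun u => by positivity)
              (hc.norm.rpow_const fun _ => Or.inr hq.le).measurable.aestronglyMeasurable]
            refine ENNReal.toReal_le_coe_of_le_coe (le_of_eq_of_le ?_ (hφK n).le)
            refine lintegral_congr fun u => ?_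
            rw [← ofReal_norm, ENNReal.ofReal_rpow_of_nonneg (norm_nonneg _) hq.le]
  have hE := hF.measurableSet_exists_limit
  set E : Set (ℕ → Circle) := {w | ∃ c, Tendsto (fun r => dilate F r w) (𝓝[<] 1) (𝓝 c)}
  have hE' : MeasurableSet {x : (ℕ → Circle) × Circle | rotate x.2 x.1 ∈ E} :=
    continuous_rotate.measurable hE
  -- After swapping the quantifiers a single rotation u works for almost every w, and invariance of
  -- the measure removes it.
  obtain ⟨u, hu⟩ := ((Measure.ae_ae_comm hE').mp hrad).exists
  rw [← (hrot u).map_eq]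
  exact (ae_map_iff (hrot u).measurable.aemeasurable hE).mpr hu

lemma tendsto_radialLimit {w : ℕ → Circle}
    (h : ∃ c, Tendsto (fun r => dilate F r w) (𝓝[<] 1) (𝓝 c)) :
    Tendsto (fun n => dilate F (radius n) w) atTop (𝓝 (radialLimit F w)) :=
  (tendsto_nhds_limUnder h).comp tendsto_radius

end

/-! ### The Poisson kernel of the infinite polydisk -/

/-- Harnack's bounds on one factor. They are linear in |a| for small a, so the product kernel
converges and is bounded above and below exactly because ζ is summable. -/
lemma norm_log_diskPoisson_le {a : ℂ} (ha : ‖a‖ < 1) (w : Circle) :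
    ‖Real.log (diskPoisson a w)‖ ≤ 2 * ‖a‖ / (1 - ‖a‖) := by
  have h1 : 0 < 1 - ‖a‖ := by linarith
  have h2 : 0 < 1 + ‖a‖ := by positivity
  have h3 : Real.log ((1 + ‖a‖) / (1 - ‖a‖)) ≤ 2 * ‖a‖ / (1 - ‖a‖) := by
    refine (Real.log_le_sub_one_of_pos (by positivity)).trans_eq ?_
    field_simp; ring
  rw [Real.norm_eq_abs, abs_le]
  constructor
  · have := Real.log_le_log (by positivity) (le_diskPoisson ha w)
    rw [← inv_div, Real.log_inv] at this
    linarith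
  · exact (Real.log_le_log (diskPoisson_pos ha w) (diskPoisson_le ha w)).trans h3

lemma summable_poisson_bound {ζ : ℕ → ℂ} (hζ : ζ ∈ polydiskOne) :
    Summable fun n => 2 * ‖ζ n‖ / (1 - ‖ζ n‖) := by
  rw [mem_polydiskOne] at hζ
  have h0 : Tendsto (fun n => ‖ζ n‖) atTop (𝓝 0) := hζ.1.tendsto_atTop_zero
  refine Summable.of_norm_bounded_eventually_nat (hζ.1.mul_left 4) ?_
  filter_upwards [h0.eventually_le_const (show (0 : ℝ) < 1 / 2 by norm_num)] with n hn
  have h1 : 0 < 1 - ‖ζ n‖ := by linarith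
  rw [Real.norm_of_nonneg (by positivity), div_le_iff₀ h1]
  nlinarith [norm_nonneg (ζ n)]

lemma summable_log_diskPoisson {ζ : ℕ → ℂ} (hζ : ζ ∈ polydiskOne) (w : ℕ → Circle) :
    Summable fun n => Real.log (diskPoisson (ζ n) (w n)) :=
  .of_norm_bounded (summable_poisson_bound hζ) fun n => norm_log_diskPoisson_le (hζ.2 n) (w n)

lemma torusPoissonKernel_eq_exp {ζ : ℕ → ℂ} (hζ : ζ ∈ polydiskOne) (w : ℕ → Circle) :
    torusPoissonKernel ζ w = Real.exp (∑' n, Real.log (diskPoisson (ζ n) (w n))) :=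
  (Real.rexp_tsum_eq_tprod (fun n => diskPoisson_pos (hζ.2 n) (w n))
    (summable_log_diskPoisson hζ w)).symm

lemma prod_diskPoisson_eq_exp {ζ : ℕ → ℂ} (hζ : ζ ∈ polydiskOne) (w : ℕ → Circle) (s : Finset ℕ) :
    ∏ n ∈ s, diskPoisson (ζ n) (w n)
      = Real.exp (∑ n ∈ s, Real.log (diskPoisson (ζ n) (w n))) := by
  rw [Real.exp_sum]
  exact Finset.prod_congr rfl fun n _ => (Real.exp_log (diskPoisson_pos (hζ.2 n) (w n))).symm

lemma tendsto_prod_diskPoisson {ζ : ℕ → ℂ} (hζ : ζ ∈ polydiskOne) (w : ℕ → Circle) :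
    Tendsto (fun N => ∏ n ∈ Finset.range N, diskPoisson (ζ n) (w n)) atTop
      (𝓝 (torusPoissonKernel ζ w)) := by
  rw [torusPoissonKernel_eq_exp hζ]
  simp_rw [prod_diskPoisson_eq_exp hζ]
  exact (Real.continuous_exp.tendsto _).comp
    (summable_log_diskPoisson hζ w).hasSum.tendsto_sum_nat

/-- A bound for the logarithm of the Poisson kernel. -/
def poissonBound (ζ : ℕ → ℂ) : ℝ := ∑' n, 2 * ‖ζ n‖ / (1 - ‖ζ n‖)

lemma prod_diskPoisson_le {ζ : ℕ → ℂ} (hζ : ζ ∈ polydiskOne) (w : ℕ → Circle) (s : Finset ℕ) :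
    ∏ n ∈ s, diskPoisson (ζ n) (w n) ≤ Real.exp (poissonBound ζ) := by
  rw [prod_diskPoisson_eq_exp hζ, Real.exp_le_exp]
  refine (Finset.sum_le_sum fun n _ => (Real.le_norm_self _).trans
    (norm_log_diskPoisson_le (hζ.2 n) (w n))).trans ?_
  refine (summable_poisson_bound hζ).sum_le_tsum s fun n _ => ?_
  have := hζ.2 n
  exact div_nonneg (by positivity) (by linarith)

lemma torusPoissonKernel_le {ζ : ℕ → ℂ} (hζ : ζ ∈ polydiskOne) (w : ℕ → Circle) :
    torusPoissonKernel ζ w ≤ Real.exp (poissonBound ζ) :=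
  le_of_tendsto' (tendsto_prod_diskPoisson hζ w) fun _ => prod_diskPoisson_le hζ w _

lemma torusPoissonKernel_ge {ζ : ℕ → ℂ} (hζ : ζ ∈ polydiskOne) (w : ℕ → Circle) :
    Real.exp (-poissonBound ζ) ≤ torusPoissonKernel ζ w := by
  rw [torusPoissonKernel_eq_exp hζ, Real.exp_le_exp, poissonBound]
  have := tsum_of_norm_bounded (summable_poisson_bound hζ).hasSum
    fun n => norm_log_diskPoisson_le (hζ.2 n) (w n)
  exact (abs_le.mp this).1

lemma torusPoissonKernel_pos {ζ : ℕ → ℂ} (hζ : ζ ∈ polydiskOne) (w : ℕ → Circle) :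
    0 < torusPoissonKernel ζ w :=
  (Real.exp_pos _).trans_le (torusPoissonKernel_ge hζ w)

lemma continuous_prod_diskPoisson {ζ : ℕ → ℂ} (hζ : ζ ∈ polydiskOne) (s : Finset ℕ) :
    Continuous fun w : ℕ → Circle => ∏ n ∈ s, diskPoisson (ζ n) (w n) :=
  continuous_finsetProd _ fun n _ => (continuous_diskPoisson (hζ.2 n)).comp (continuous_apply n)

lemma measurable_torusPoissonKernel {ζ : ℕ → ℂ} (hζ : ζ ∈ polydiskOne) :
    Measurable (torusPoissonKernel ζ) :=
  measurable_of_tendsto_metrizable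
    (fun N => (continuous_prod_diskPoisson hζ (Finset.range N)).measurable)
    (tendsto_pi_nhds.mpr fun w => tendsto_prod_diskPoisson hζ w)

lemma integrable_torusPoissonKernel_mul {ζ : ℕ → ℂ} (hζ : ζ ∈ polydiskOne)
    {g : (ℕ → Circle) → ℝ} (hg : Integrable g torusMeasure) :
    Integrable (fun w => torusPoissonKernel ζ w * g w) torusMeasure := by
  refine hg.bdd_mul (measurable_torusPoissonKernel hζ).aestronglyMeasurable
    (c := Real.exp (poissonBound ζ)) (.of_forall fun w => ?_)
  rw [Real.norm_of_nonneg (torusPoissonKernel_pos hζ w).le]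
  exact torusPoissonKernel_le hζ w

/-- The factor at coordinate value 0 equals 1, so putting 0 there removes that factor from the
product. -/
lemma torusPoissonKernel_update {ζ : ℕ → ℂ} (hζ : ζ ∈ polydiskOne) (k : ℕ) {z : ℂ} (hz : ‖z‖ < 1)
    (w : ℕ → Circle) : torusPoissonKernel (Function.update ζ k z) w
      = diskPoisson z (w k) * torusPoissonKernel (Function.update ζ k 0) w := by
  have hz' := update_mem_polydiskOne hζ k hz
  have h0 := update_mem_polydiskOne hζ k (z := 0) (by simp)
  rw [torusPoissonKernel_eq_exp hz', torusPoissonKernel_eq_exp h0,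
    (summable_log_diskPoisson hz' w).tsum_eq_add_tsum_ite k, Function.update_self, Real.exp_add,
    Real.exp_log (diskPoisson_pos hz (w k))]
  congr 3
  ext n
  rcases eq_or_ne n k with rfl | h
  · simp [diskPoisson, Circle.norm_coe]
  · simp [h]

/-! ### The Poisson majorant of `log ‖F‖` -/

lemma integrable_of_continuous_torus {g : (ℕ → Circle) → ℝ} (hg : Continuous g) :
    Integrable g torusMeasure :=
  hg.integrable_of_hasCompactSupport (HasCompactSupport.of_compactSpace g)

section

variable {F : (ℕ → ℂ) → ℂ}

/-- The one-variable submean inequality is applied to one coordinate after another, replacing ηₙ by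
a point of the circle; the dilation by ρ makes the limit over all coordinates a dominated one. -/
lemma logMax_dilate_le_integral (hF : HolomorphicOnPolydiskTwo F) {η : ℕ → ℂ}
    (hη : η ∈ polydiskOne) {ρ : ℝ} (hρ : ρ ∈ Set.Ioo (0 : ℝ) 1) {ε : ℝ} (hε : 0 < ε) :
    logMax ε ‖F fun n => (ρ : ℂ) ^ (n + 1) * η n‖
      ≤ ∫ w, torusPoissonKernel η w * logMax ε ‖dilate F ρ w‖ ∂torusMeasure := by
  set pt : ℕ → (ℕ → Circle) → ℕ → ℂ := fun N w n =>
    (ρ : ℂ) ^ (n + 1) * if n < N then (w n : ℂ) else η n with hpt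
  have hbase : ∀ (N : ℕ) (w : ℕ → Circle) (n : ℕ), ‖(if n < N then (w n : ℂ) else η n)‖ ≤ 1 := by
    intro N w n
    split_ifs
    · rw [Circle.norm_coe]
    · exact (hη.2 n).le
  have hscale : ∀ (x : ℂ) (n : ℕ), ‖x‖ ≤ 1 → ‖(ρ : ℂ) ^ (n + 1) * x‖ ≤ ρ ^ (n + 1) := by
    intro x n hx
    rw [norm_mul, norm_pow, Complex.norm_real, Real.norm_of_nonneg hρ.1.le]
    exact mul_le_of_le_one_right (pow_nonneg hρ.1.le _) hx
  have hptb : ∀ N w n, ‖pt N w n‖ ≤ ρ ^ (n + 1) := fun N w n => hscale _ _ (hbase N w n)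
  have hptc : ∀ N, Continuous fun w => F (pt N w) := fun N =>
    hF.continuous_comp (fun n => by
      by_cases h : n < N
      · simp only [hpt, h, if_true]; fun_prop
      · simp only [hpt, h, if_false]; fun_prop) hρ (hptb N)
  -- All points `pt N w` lie in the image of a product of closed disks, compact by Tychonoff, on
  -- which the dilated F is continuous.
  obtain ⟨B, hB⟩ : ∃ B, ∀ N w, ‖F (pt N w)‖ ≤ B := by
    let Y := ℕ → Metric.closedBall (0 : ℂ) 1
    have hc : Continuous fun y : Y => F fun n => (ρ : ℂ) ^ (n + 1) * (y n : ℂ) :=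
      hF.continuous_comp (fun n => by fun_prop) hρ fun y n =>
        hscale _ _ (mem_closedBall_zero_iff.mp (y n).2)
    obtain ⟨B, hB⟩ := isCompact_univ.exists_bound_of_continuousOn hc.continuousOn
    exact ⟨B, fun N w => hB (fun n => ⟨_, mem_closedBall_zero_iff.mpr (hbase N w n)⟩) trivial⟩
  set K : ℕ → (ℕ → Circle) → ℝ := fun N w => ∏ n ∈ Finset.range N, diskPoisson (η n) (w n) with hK
  have hKpos : ∀ N w, 0 < K N w := fun N w => Finset.prod_pos fun n _ => diskPoisson_pos (hη.2 n) _
  have hgc : ∀ N, Continuous fun w => K N w * logMax ε ‖F (pt N w)‖ := fun N =>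
    (continuous_prod_diskPoisson hη _).mul ((continuous_logMax hε).comp (hptc N).norm)
  have hptOne : ∀ N w, pt N w ∈ polydiskOne := fun N w => mem_polydiskOne.mpr
    ⟨(summable_pow_succ hρ.1.le hρ.2).of_nonneg_of_le (fun n => norm_nonneg _) (hptb N w),
      fun n => (hptb N w n).trans_lt (pow_lt_one₀ hρ.1.le hρ.2 n.succ_ne_zero)⟩
  have hstep : ∀ N, ∫ w, K N w * logMax ε ‖F (pt N w)‖ ∂torusMeasure
      ≤ ∫ w, K (N + 1) w * logMax ε ‖F (pt (N + 1) w)‖ ∂torusMeasure := by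
    intro N
    rw [integral_torus_update (integrable_of_continuous_torus (hgc (N + 1))) N]
    have hKu : ∀ w t, K (N + 1) (Function.update w N t) = K N w * diskPoisson (η N) t := by
      intro w t
      simp only [hK, Finset.prod_range_succ, Function.update_self]
      congr 1
      refine Finset.prod_congr rfl fun n hn => ?_
      rw [Function.update_of_ne (Finset.mem_range.mp hn).ne]
    have hρN : ρ ^ (N + 1) ∈ Set.Ioo (0 : ℝ) 1 :=
      ⟨pow_pos hρ.1 _, pow_lt_one₀ hρ.1.le hρ.2 N.succ_ne_zero⟩
    set f : (ℕ → Circle) → ℂ → ℂ := fun w z =>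
      F (Function.update (pt N w) N (((ρ ^ (N + 1) : ℝ) : ℂ) * z)) with hf
    have hfd : ∀ w, DiffContOnCl ℂ (f w) (Metric.ball 0 1) := fun w =>
      diffContOnCl_dilate (hF.differentiableOn_update (hptOne N w) N) hρN
    have hfη : ∀ w, f w (η N) = F (pt N w) := by
      intro w
      simp only [hf]
      congr 1
      rw [Function.update_eq_self_iff]
      simp [hpt]
    have hft : ∀ w (t : Circle), F (pt (N + 1) (Function.update w N t)) = f w t := by
      intro w t
      simp only [hf]
      congr 1
      ext n
      rcases eq_or_ne n N with rfl | hn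
      · simp [hpt]
      · simp only [hpt, Function.update_of_ne hn]
        congr 1
        have : n < N + 1 ↔ n < N := by omega
        simp only [this]
    refine integral_mono (integrable_of_continuous_torus (hgc N))
      (integrable_integral_torus_update (integrable_of_continuous_torus (hgc (N + 1))) N) fun w => ?_
    simp only [hKu, hft, mul_assoc]
    rw [integral_const_mul, ← hfη]
    exact mul_le_mul_of_nonneg_left (logMax_le_integral_diskPoisson (hfd w) hε (hη.2 N))
      (hKpos N w).le
  have hmono : ∀ N, ∫ w, K 0 w * logMax ε ‖F (pt 0 w)‖ ∂torusMeasure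
      ≤ ∫ w, K N w * logMax ε ‖F (pt N w)‖ ∂torusMeasure := fun N =>
    monotone_nat_of_le_succ hstep N.zero_le
  have h0 : ∫ w, K 0 w * logMax ε ‖F (pt 0 w)‖ ∂torusMeasure
      = logMax ε ‖F fun n => (ρ : ℂ) ^ (n + 1) * η n‖ := by
    simp [hK, hpt]
  rw [h0] at hmono
  have hlim : Tendsto (fun N => ∫ w, K N w * logMax ε ‖F (pt N w)‖ ∂torusMeasure) atTop
      (𝓝 (∫ w, torusPoissonKernel η w * logMax ε ‖dilate F ρ w‖ ∂torusMeasure)) := by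
    refine tendsto_integral_of_dominated_convergence
      (fun _ => Real.exp (poissonBound η) * max |Real.log ε| |logMax ε B|)
      (fun N => (hgc N).measurable.aestronglyMeasurable) (integrable_const _)
      (fun N => .of_forall fun w => ?_) (.of_forall fun w => ?_)
    · rw [norm_mul, Real.norm_of_nonneg (hKpos N w).le]
      gcongr
      · exact prod_diskPoisson_le hη w _
      · rw [Real.norm_eq_abs]
        exact abs_le_max_abs_abs (log_le_logMax hε _) (logMax_mono hε (hB N w))
    · refine (tendsto_prod_diskPoisson hη w).mul
        (((continuous_logMax hε).tendsto _).comp (Tendsto.norm ?_))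
      refine hF.tendsto (summable_pow_succ_sq hρ.1.le hρ.2) (.of_forall fun N n => ⟨hptb N w n,
        (hptOne N w).2 n⟩) (fun n => ⟨(norm_dilate_arg hρ w n).le, ?_⟩) fun n => ?_
      · exact (dilate_arg_mem hρ w).2 n
      · refine tendsto_const_nhds.congr' ?_
        filter_upwards [eventually_gt_atTop n] with N hN
        simp [hpt, hN]
  exact ge_of_tendsto' hlim hmono

end

/-! ### Passage to radial limits: the Poisson majorant and integrability of log|F*| -/

section

variable {F : (ℕ → ℂ) → ℂ}

lemma abs_logMax_le {q ε x : ℝ} (hq : 0 < q) (hε : ε ∈ Set.Ioc (0 : ℝ) 1) (hx : 0 ≤ x) :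
    |logMax ε x| ≤ |Real.log ε| + x ^ q / q := by
  have h1 := log_le_logMax hε.1 x
  have h2 : logMax ε x ≤ logMax 1 x :=
    Real.log_le_log (hε.1.trans_le (le_max_right _ _)) (max_le_max_left _ hε.2)
  have h3 := logMax_one_le_rpow hq hx
  have h4 : 0 ≤ x ^ q / q := by positivity
  rw [abs_le]
  constructor
  · linarith [neg_abs_le (Real.log ε)]
  · linarith [abs_nonneg (Real.log ε)]

/-- Applying the logarithmic bound with exponent q/2 and squaring costs only xᑫ. The Hardy bound
thus controls the truncated logarithms of all dilations in L², which gives uniform integrability. -/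
lemma sq_logMax_le {q ε x : ℝ} (hq : 0 < q) (hε : ε ∈ Set.Ioc (0 : ℝ) 1) (hx : 0 ≤ x) :
    logMax ε x ^ 2 ≤ 2 * Real.log ε ^ 2 + 8 / q ^ 2 * x ^ q := by
  have h1 := abs_logMax_le (half_pos hq) hε hx
  have h2 : (x ^ (q / 2)) ^ 2 = x ^ q := by
    rw [← Real.rpow_natCast, ← Real.rpow_mul hx]; norm_num
  have h3 : logMax ε x ^ 2 ≤ (|Real.log ε| + x ^ (q / 2) / (q / 2)) ^ 2 := by
    rw [← sq_abs]; gcongr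
  have h4 : (x ^ (q / 2) / (q / 2)) ^ 2 = 4 / q ^ 2 * x ^ q := by
    rw [div_pow, h2]; field_simp; norm_num
  have h5 := sq_abs (Real.log ε)
  have h6 := sq_nonneg (|Real.log ε| - x ^ (q / 2) / (q / 2))
  calc _ ≤ _ := h3
    _ ≤ 2 * |Real.log ε| ^ 2 + 2 * (x ^ (q / 2) / (q / 2)) ^ 2 := by linarith [h6]
    _ = _ := by rw [h4, h5]; ring

/-- The hypotheses on a holomorphic function under which its radial limits are studied. -/
structure HasHardyBound (F : (ℕ → ℂ) → ℂ) (q : ℝ) (C : ℝ≥0∞) : Prop where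
  hol : HolomorphicOnPolydiskTwo F
  pos : 0 < q
  lt_top : C < ∞
  bound : ∀ r ∈ Set.Ioo (0 : ℝ) 1, ∫⁻ w, ‖dilate F r w‖ₑ ^ q ∂torusMeasure ≤ C

lemma MemHardy.exists_hasHardyBound {p : ℝ≥0∞} (hp : 0 < p) (hF : MemHardy p F) :
    ∃ q C, HasHardyBound F q C := by
  obtain ⟨q, hq, C, hC, h⟩ := exists_lintegral_bound hp hF
  exact ⟨q, C, hF.1, hq, hC, h⟩

namespace HasHardyBound

variable {q : ℝ} {C : ℝ≥0∞}

lemma ae_tendsto (hF : HasHardyBound F q C) : ∀ᵐ w ∂torusMeasure,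
    Tendsto (fun n => dilate F (radius n) w) atTop (𝓝 (radialLimit F w)) := by
  filter_upwards [hF.hol.ae_exists_limit hF.pos hF.lt_top hF.bound] with w hw
  exact tendsto_radialLimit hw

lemma aemeasurable_radialLimit (hF : HasHardyBound F q C) :
    AEMeasurable (radialLimit F) torusMeasure :=
  aemeasurable_of_tendsto_metrizable_ae' (fun n =>
    (hF.hol.continuous_dilate (radius_mem n)).measurable.aemeasurable) hF.ae_tendsto

lemma lintegral_radialLimit_le (hF : HasHardyBound F q C) :
    ∫⁻ w, ‖radialLimit F w‖ₑ ^ q ∂torusMeasure ≤ C := by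
  have hm : ∀ n, Measurable fun w => ‖dilate F (radius n) w‖ₑ ^ q := fun n =>
    (hF.hol.continuous_dilate (radius_mem n)).measurable.enorm.pow_const q
  calc _ = ∫⁻ w, liminf (fun n => ‖dilate F (radius n) w‖ₑ ^ q) atTop ∂torusMeasure := by
        refine lintegral_congr_ae ?_
        filter_upwards [hF.ae_tendsto] with w hw
        exact (((ENNReal.continuous_rpow_const.tendsto _).comp hw.enorm).liminf_eq).symm
    _ ≤ _ := lintegral_liminf_le hm
    _ ≤ C := liminf_le_of_le (by isBoundedDefault) fun b hb =>
        let ⟨n, hn⟩ := hb.exists; hn.trans (hF.bound _ (radius_mem n))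

lemma integrable_rpow (hF : HasHardyBound F q C) :
    Integrable (fun w => ‖radialLimit F w‖ ^ q) torusMeasure := by
  refine ⟨(hF.aemeasurable_radialLimit.norm.pow_const q).aestronglyMeasurable, ?_⟩
  refine lt_of_le_of_lt (le_of_eq_of_le (lintegral_congr fun w => ?_) hF.lintegral_radialLimit_le)
    hF.lt_top
  rw [Real.enorm_of_nonneg (by positivity), ← ofReal_norm,
    ENNReal.ofReal_rpow_of_nonneg (norm_nonneg _) hF.pos.le]

lemma integrable_logMax (hF : HasHardyBound F q C) {ε : ℝ} (hε : ε ∈ Set.Ioc (0 : ℝ) 1) :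
    Integrable (fun w => logMax ε ‖radialLimit F w‖) torusMeasure := by
  refine ((integrable_const |Real.log ε|).add (hF.integrable_rpow.div_const q)).mono'
    ((continuous_logMax hε.1).measurable.comp_aemeasurable
      hF.aemeasurable_radialLimit.norm).aestronglyMeasurable (.of_forall fun w => ?_)
  exact abs_logMax_le hF.pos hε (norm_nonneg _)

lemma integral_dilate_rpow_le (hF : HasHardyBound F q C) (n : ℕ) :
    ∫ w, ‖dilate F (radius n) w‖ ^ q ∂torusMeasure ≤ C.toReal := by
  rw [integral_eq_lintegral_of_nonneg_ae (.of_forall fun u => by positivity)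
    ((hF.hol.continuous_dilate (radius_mem n)).norm.rpow_const
      fun _ => Or.inr hF.pos.le).measurable.aestronglyMeasurable]
  refine ENNReal.toReal_mono hF.lt_top.ne (le_of_eq_of_le ?_ (hF.bound _ (radius_mem n)))
  refine lintegral_congr fun u => ?_
  rw [← ofReal_norm, ENNReal.ofReal_rpow_of_nonneg (norm_nonneg _) hF.pos.le]

/-- The inequality for dilations survives ρ → 1. Below a level K convergence is dominated, and the
part above K costs at most a multiple of 1/K by the L² bound. -/
lemma logMax_le_integral (hF : HasHardyBound F q C) {η : ℕ → ℂ} (hη : η ∈ polydiskOne) {ε : ℝ}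
    (hε : ε ∈ Set.Ioc (0 : ℝ) 1) : logMax ε ‖F η‖
      ≤ ∫ w, torusPoissonKernel η w * logMax ε ‖radialLimit F w‖ ∂torusMeasure := by
  set M := Real.exp (poissonBound η) with hM
  set B := 2 * Real.log ε ^ 2 + 8 / q ^ 2 * C.toReal with hB
  have hq := hF.pos
  have hB0 : 0 ≤ B := by positivity
  have hPpos := fun w => (torusPoissonKernel_pos hη w).le
  have hGc : ∀ n, Continuous fun w => logMax ε ‖dilate F (radius n) w‖ := fun n =>
    (continuous_logMax hε.1).comp (hF.hol.continuous_dilate (radius_mem n)).norm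
  have hG2 : ∀ n, ∫ w, logMax ε ‖dilate F (radius n) w‖ ^ 2 ∂torusMeasure ≤ B := by
    intro n
    have hi : Integrable (fun w => ‖dilate F (radius n) w‖ ^ q) torusMeasure :=
      integrable_of_continuous_torus ((hF.hol.continuous_dilate (radius_mem n)).norm.rpow_const
        fun _ => Or.inr hq.le)
    calc _ ≤ ∫ w, (2 * Real.log ε ^ 2 + 8 / q ^ 2 * ‖dilate F (radius n) w‖ ^ q) ∂torusMeasure :=
          integral_mono (integrable_of_continuous_torus ((hGc n).pow 2))
            ((integrable_const _).add (hi.const_mul _))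
            fun w => sq_logMax_le hq hε (norm_nonneg _)
      _ = 2 * Real.log ε ^ 2 + 8 / q ^ 2 * ∫ w, ‖dilate F (radius n) w‖ ^ q ∂torusMeasure := by
          rw [integral_add (integrable_const _) (hi.const_mul _), integral_const_mul (8 / q ^ 2)]; simp
      _ ≤ B := by rw [hB]; gcongr; exact hF.integral_dilate_rpow_le n
  have hradius : Tendsto (fun n => (radius n : ℂ)) atTop (𝓝 1) := by
    have := (Complex.continuous_ofReal.tendsto 1).comp
      ((tendsto_nhdsWithin_iff.mp tendsto_radius).1)
    simpa [Function.comp_def] using this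
  have hleft : Tendsto (fun j => logMax ε ‖F fun n => (radius j : ℂ) ^ (n + 1) * η n‖) atTop
      (𝓝 (logMax ε ‖F η‖)) := by
    refine ((continuous_logMax hε.1).tendsto _).comp (Tendsto.norm ?_)
    have h1 := mem_polydiskTwo.mp (polydiskOne_subset hη)
    refine hF.hol.tendsto (b := fun n => ‖η n‖) h1.1 (.of_forall fun j n => ?_)
      (fun n => ⟨le_rfl, h1.2 n⟩) fun n => ?_
    · have h2 : ‖(radius j : ℂ) ^ (n + 1) * η n‖ ≤ ‖η n‖ := by
        rw [norm_mul, norm_pow, Complex.norm_real, Real.norm_of_nonneg (radius_mem j).1.le]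
        exact mul_le_of_le_one_left (norm_nonneg _)
          (pow_le_one₀ (radius_mem j).1.le (radius_mem j).2.le)
      exact ⟨h2, h2.trans_lt (h1.2 n)⟩
    · simpa using (hradius.pow (n + 1)).mul_const (η n)
  have key : ∀ K > |Real.log ε|, logMax ε ‖F η‖
      ≤ ∫ w, torusPoissonKernel η w * logMax ε ‖radialLimit F w‖ ∂torusMeasure + M * B / K := by
    intro K hK
    have hK0 : 0 < K := (abs_nonneg _).trans_lt hK
    have hminb : ∀ x, ‖min (logMax ε x) K‖ ≤ K := fun x => by
      rw [Real.norm_eq_abs, abs_le]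
      have h1 := log_le_logMax hε.1 x
      have h2 := neg_abs_le (Real.log ε)
      exact ⟨le_min (by linarith) (by linarith), min_le_right _ _⟩
    have hminc : Continuous fun x => min (logMax ε x) K :=
      (continuous_logMax hε.1).min continuous_const
    have hright : Tendsto (fun n => ∫ w, torusPoissonKernel η w
          * min (logMax ε ‖dilate F (radius n) w‖) K ∂torusMeasure) atTop
        (𝓝 (∫ w, torusPoissonKernel η w * min (logMax ε ‖radialLimit F w‖) K ∂torusMeasure)) := by
      refine tendsto_integral_of_dominated_convergence (fun _ => M * K) (fun n => ?_)
        (integrable_const _) (fun n => .of_forall fun w => ?_) ?_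
      · exact ((measurable_torusPoissonKernel hη).mul (hminc.measurable.comp
          (hF.hol.continuous_dilate (radius_mem n)).norm.measurable)).aestronglyMeasurable
      · rw [norm_mul, Real.norm_of_nonneg (hPpos w)]
        gcongr
        · exact torusPoissonKernel_le hη w
        · exact hminb _
      · filter_upwards [hF.ae_tendsto] with w hw
        exact ((hminc.tendsto _).comp hw.norm).const_mul _
    have hstep : ∀ n, logMax ε ‖F fun k => (radius n : ℂ) ^ (k + 1) * η k‖
        ≤ ∫ w, torusPoissonKernel η w * min (logMax ε ‖dilate F (radius n) w‖) K ∂torusMeasure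
          + M * B / K := by
      intro n
      refine (logMax_dilate_le_integral hF.hol hη (radius_mem n) hε.1).trans ?_
      have hi1 : Integrable (fun w => torusPoissonKernel η w
          * min (logMax ε ‖dilate F (radius n) w‖) K) torusMeasure :=
        integrable_torusPoissonKernel_mul hη (integrable_of_continuous_torus
          ((hGc n).min continuous_const))
      have hi2 : Integrable (fun w => M / K * logMax ε ‖dilate F (radius n) w‖ ^ 2) torusMeasure :=
        (integrable_of_continuous_torus ((hGc n).pow 2)).const_mul _
      calc _ ≤ ∫ w, (torusPoissonKernel η w * min (logMax ε ‖dilate F (radius n) w‖) K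
              + M / K * logMax ε ‖dilate F (radius n) w‖ ^ 2) ∂torusMeasure := by
            refine integral_mono (integrable_torusPoissonKernel_mul hη
              (integrable_of_continuous_torus (hGc n))) (hi1.add hi2) fun w => ?_
            set x := logMax ε ‖dilate F (radius n) w‖
            -- Chebyshev's trick: when x ≥ K, x itself is at most x²/K.
            have h1 : x ≤ min x K + x ^ 2 / K := by
              rcases le_total x K with h | h
              · rw [min_eq_left h]; have : 0 ≤ x ^ 2 / K := by positivity
                linarith
              · rw [min_eq_right h]
                have : x ≤ x ^ 2 / K := by rw [le_div_iff₀ hK0]; nlinarith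
                linarith
            calc torusPoissonKernel η w * x ≤ torusPoissonKernel η w * (min x K + x ^ 2 / K) :=
                  mul_le_mul_of_nonneg_left h1 (hPpos w)
              _ = torusPoissonKernel η w * min x K + torusPoissonKernel η w * (x ^ 2 / K) :=
                  mul_add _ _ _
              _ ≤ torusPoissonKernel η w * min x K + M * (x ^ 2 / K) := by
                  gcongr; exact torusPoissonKernel_le hη w
              _ = _ := by ring
        _ = _ + M / K * ∫ w, logMax ε ‖dilate F (radius n) w‖ ^ 2 ∂torusMeasure := by
            rw [integral_add hi1 hi2, integral_const_mul]
        _ ≤ _ + M / K * B := by gcongr; exact hG2 n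
        _ = _ := by ring
    refine (le_of_tendsto_of_tendsto' hleft (hright.add_const (M * B / K)) hstep).trans ?_
    gcongr ?_ + _
    have hiG := hF.integrable_logMax hε
    refine integral_mono (integrable_torusPoissonKernel_mul hη ?_)
      (integrable_torusPoissonKernel_mul hη hiG) fun w =>
        mul_le_mul_of_nonneg_left (min_le_left _ _) (hPpos w)
    exact hiG.inf (integrable_const K)
  have hlim : Tendsto (fun K : ℝ => ∫ w, torusPoissonKernel η w * logMax ε ‖radialLimit F w‖
      ∂torusMeasure + M * B / K) atTop (𝓝 (∫ w, torusPoissonKernel η w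
        * logMax ε ‖radialLimit F w‖ ∂torusMeasure + 0)) :=
    tendsto_const_nhds.add (tendsto_const_nhds.div_atTop tendsto_id)
  rw [add_zero] at hlim
  refine ge_of_tendsto hlim ?_
  filter_upwards [eventually_gt_atTop |Real.log ε|] with K hK using key K hK

lemma tendsto_logMax_exp_neg {x : ℝ} (hx : 0 < x) :
    ∀ᶠ n : ℕ in atTop, logMax (Real.exp (-n)) x = Real.log x := by
  have h1 : Tendsto (fun n : ℕ => Real.exp (-n)) atTop (𝓝 0) :=
    Real.tendsto_exp_neg_atTop_nhds_zero.comp tendsto_natCast_atTop_atTop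
  filter_upwards [h1.eventually_le_const hx] with n hn
  rw [logMax, max_eq_left hn]

lemma exp_neg_mem (n : ℕ) : Real.exp (-n) ∈ Set.Ioc (0 : ℝ) 1 :=
  ⟨Real.exp_pos _, Real.exp_le_one_iff.mpr (by simp)⟩

lemma logMax_le_logMax_one {ε : ℝ} (hε : ε ∈ Set.Ioc (0 : ℝ) 1) (x : ℝ) :
    logMax ε x ≤ logMax 1 x :=
  Real.log_le_log (hε.1.trans_le (le_max_right _ _)) (max_le_max_left _ hε.2)

/-- The majorant at a point with F(η) ≠ 0 bounds the truncated Poisson integrals below by log|F(η)|,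
uniformly in the truncation. The integrand is nonnegative and P_η is at least a positive constant,
so the kernel can be dropped; Fatou's lemma then applies. -/
lemma ae_liminf_lt_top (hF : HasHardyBound F q C) {η : ℕ → ℂ} (hη : η ∈ polydiskOne)
    (h0 : F η ≠ 0) :
    ∫⁻ w, liminf (fun n : ℕ => ENNReal.ofReal (logMax 1 ‖radialLimit F w‖
      - logMax (Real.exp (-n)) ‖radialLimit F w‖)) atTop ∂torusMeasure < ∞ := by
  have h1 : (1 : ℝ) ∈ Set.Ioc (0 : ℝ) 1 := ⟨one_pos, le_rfl⟩
  set c := Real.exp (-poissonBound η) with hc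
  have hcpos : 0 < c := Real.exp_pos _
  set J := ∫ w, torusPoissonKernel η w * logMax 1 ‖radialLimit F w‖ ∂torusMeasure
    - Real.log ‖F η‖ with hJ
  have hi : ∀ n : ℕ, Integrable (fun w => logMax 1 ‖radialLimit F w‖
      - logMax (Real.exp (-n)) ‖radialLimit F w‖) torusMeasure := fun n =>
    (hF.integrable_logMax h1).sub (hF.integrable_logMax (exp_neg_mem n))
  have hb : ∀ n : ℕ, ∫ w, (logMax 1 ‖radialLimit F w‖
      - logMax (Real.exp (-n)) ‖radialLimit F w‖) ∂torusMeasure ≤ J / c := by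
    intro n
    rw [le_div_iff₀ hcpos, mul_comm, ← integral_const_mul]
    have h2 := hF.logMax_le_integral hη (exp_neg_mem n)
    have h3 : Real.log ‖F η‖ ≤ logMax (Real.exp (-n)) ‖F η‖ :=
      Real.log_le_log (norm_pos_iff.mpr h0) (le_max_left _ _)
    calc _ ≤ ∫ w, torusPoissonKernel η w * (logMax 1 ‖radialLimit F w‖
          - logMax (Real.exp (-n)) ‖radialLimit F w‖) ∂torusMeasure := by
          refine integral_mono ((hi n).const_mul c) (integrable_torusPoissonKernel_mul hη (hi n))
            fun w => ?_
          exact mul_le_mul_of_nonneg_right (torusPoissonKernel_ge hη w)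
            (sub_nonneg.mpr (logMax_le_logMax_one (exp_neg_mem n) _))
      _ = ∫ w, torusPoissonKernel η w * logMax 1 ‖radialLimit F w‖ ∂torusMeasure
          - ∫ w, torusPoissonKernel η w * logMax (Real.exp (-n)) ‖radialLimit F w‖
            ∂torusMeasure := by
          rw [← integral_sub
            (integrable_torusPoissonKernel_mul hη (hF.integrable_logMax h1))
            (integrable_torusPoissonKernel_mul hη (hF.integrable_logMax (exp_neg_mem n)))]
          simp_rw [mul_sub]
      _ ≤ J := by rw [hJ]; linarith
  refine (lintegral_liminf_le' fun n => (hi n).aestronglyMeasurable.aemeasurable.ennreal_ofReal).trans_lt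
    (lt_of_le_of_lt (b := ENNReal.ofReal (J / c)) ?_ ENNReal.ofReal_lt_top)
  refine liminf_le_of_le (by isBoundedDefault) fun b hb' => ?_
  obtain ⟨n, hn⟩ := hb'.exists
  refine hn.trans ?_
  rw [← ofReal_integral_eq_lintegral_ofReal (hi n)
    (.of_forall fun w => sub_nonneg.mpr (logMax_le_logMax_one (exp_neg_mem n) _))]
  exact ENNReal.ofReal_le_ofReal (hb n)

/-- At a zero of F* the difference of truncated logarithms is n, so its lower limit is infinite;
that happens only on a null set. -/
lemma ae_ne_zero (hF : HasHardyBound F q C) {η : ℕ → ℂ} (hη : η ∈ polydiskOne) (h0 : F η ≠ 0) :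
    ∀ᵐ w ∂torusMeasure, radialLimit F w ≠ 0 := by
  have hm : AEMeasurable (fun w => liminf (fun n : ℕ => ENNReal.ofReal
      (logMax 1 ‖radialLimit F w‖ - logMax (Real.exp (-n)) ‖radialLimit F w‖)) atTop)
      torusMeasure := by
    have hR := hF.aemeasurable_radialLimit
    refine ⟨fun w => liminf (fun n : ℕ => ENNReal.ofReal (logMax 1 ‖hR.mk _ w‖
      - logMax (Real.exp (-n)) ‖hR.mk _ w‖)) atTop, .liminf fun n => Measurable.ennreal_ofReal ?_, ?_⟩
    · exact ((continuous_logMax one_pos).measurable.comp hR.measurable_mk.norm).sub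
        ((continuous_logMax (Real.exp_pos _)).measurable.comp hR.measurable_mk.norm)
    · filter_upwards [hR.ae_eq_mk] with w hw
      simp only [← hw]
  filter_upwards [ae_lt_top' hm (hF.ae_liminf_lt_top hη h0).ne] with w hw hzero
  have h1 : ∀ n : ℕ, logMax 1 ‖radialLimit F w‖ - logMax (Real.exp (-n)) ‖radialLimit F w‖ = n := by
    intro n
    simp [hzero, logMax, (Real.exp_pos _).le]
  simp_rw [h1] at hw
  have h2 : Tendsto (fun n : ℕ => ENNReal.ofReal (n : ℝ)) atTop (𝓝 ∞) := by
    simpa using ENNReal.tendsto_nat_nhds_top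
  rw [h2.liminf_eq] at hw
  exact lt_irrefl _ hw

/-- Where F* ≠ 0 the truncation is eventually inactive, so the lower limit above equals log⁺|F*| -
log|F*|. -/
lemma integrable_log (hF : HasHardyBound F q C) {η : ℕ → ℂ} (hη : η ∈ polydiskOne)
    (h0 : F η ≠ 0) : Integrable (fun w => Real.log ‖radialLimit F w‖) torusMeasure := by
  have hne := hF.ae_ne_zero hη h0
  have hL1 := hF.integrable_logMax ⟨one_pos, le_refl (1 : ℝ)⟩
  have hm : AEStronglyMeasurable (fun w => Real.log ‖radialLimit F w‖) torusMeasure :=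
    (Real.measurable_log.comp_aemeasurable hF.aemeasurable_radialLimit.norm).aestronglyMeasurable
  have hdiff : Integrable (fun w => logMax 1 ‖radialLimit F w‖ - Real.log ‖radialLimit F w‖)
      torusMeasure := by
    refine ⟨hL1.aestronglyMeasurable.sub hm, ?_⟩
    refine lt_of_le_of_lt (le_of_eq (lintegral_congr_ae ?_)) (hF.ae_liminf_lt_top hη h0)
    filter_upwards [hne] with w hw
    have hpos := norm_pos_iff.mpr hw
    have h1 : Real.log ‖radialLimit F w‖ ≤ logMax 1 ‖radialLimit F w‖ :=
      Real.log_le_log hpos (le_max_left _ _)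
    rw [Real.enorm_of_nonneg (sub_nonneg.mpr h1)]
    refine (Tendsto.liminf_eq (tendsto_const_nhds.congr' ?_)).symm
    filter_upwards [tendsto_logMax_exp_neg hpos] with n hn
    rw [hn]
  refine (hL1.sub hdiff).congr (.of_forall fun w => ?_)
  simp

/-- The Poisson majorant of `log ‖F‖`. -/
lemma norm_le_exp_integral (hF : HasHardyBound F q C) (hne : ∃ η ∈ polydiskOne, F η ≠ 0)
    {η : ℕ → ℂ} (hη : η ∈ polydiskOne) :
    ‖F η‖ ≤ Real.exp (∫ w, torusPoissonKernel η w * Real.log ‖radialLimit F w‖ ∂torusMeasure) := by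
  obtain ⟨η₀, hη₀, h0⟩ := hne
  rcases eq_or_ne (F η) 0 with h | h
  · rw [h, norm_zero]; exact (Real.exp_pos _).le
  have hnz := hF.ae_ne_zero hη₀ h0
  have hL1 := hF.integrable_logMax ⟨one_pos, le_refl (1 : ℝ)⟩
  have hlog := hF.integrable_log hη₀ h0
  have hlim : Tendsto (fun n : ℕ => ∫ w, torusPoissonKernel η w
      * logMax (Real.exp (-n)) ‖radialLimit F w‖ ∂torusMeasure) atTop
      (𝓝 (∫ w, torusPoissonKernel η w * Real.log ‖radialLimit F w‖ ∂torusMeasure)) := by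
    -- Every truncation lies between log|F*| and log⁺|F*|, both integrable.
    refine tendsto_integral_of_dominated_convergence
      (fun w => torusPoissonKernel η w * (|logMax 1 ‖radialLimit F w‖|
        + |Real.log ‖radialLimit F w‖|)) (fun n => (integrable_torusPoissonKernel_mul hη
          (hF.integrable_logMax (exp_neg_mem n))).aestronglyMeasurable)
      (integrable_torusPoissonKernel_mul hη (hL1.abs.add hlog.abs)) (fun n => ?_) ?_
    · filter_upwards [hnz] with w hw
      have hpos := norm_pos_iff.mpr hw
      rw [norm_mul, Real.norm_of_nonneg (torusPoissonKernel_pos hη w).le]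
      refine mul_le_mul_of_nonneg_left ?_ (torusPoissonKernel_pos hη w).le
      have h1 : Real.log ‖radialLimit F w‖ ≤ logMax (Real.exp (-n)) ‖radialLimit F w‖ :=
        Real.log_le_log hpos (le_max_left _ _)
      have h2 := logMax_le_logMax_one (exp_neg_mem n) ‖radialLimit F w‖
      rw [Real.norm_eq_abs, abs_le]
      constructor
      · linarith [neg_abs_le (Real.log ‖radialLimit F w‖), abs_nonneg (logMax 1 ‖radialLimit F w‖)]
      · linarith [abs_nonneg (Real.log ‖radialLimit F w‖), le_abs_self (logMax 1 ‖radialLimit F w‖)]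
    · filter_upwards [hnz] with w hw
      refine tendsto_const_nhds.congr' ?_
      filter_upwards [tendsto_logMax_exp_neg (norm_pos_iff.mpr hw)] with n hn
      rw [hn]
  rw [← Real.log_le_iff_le_exp (norm_pos_iff.mpr h)]
  refine ge_of_tendsto' hlim fun n => ?_
  exact (Real.log_le_log (norm_pos_iff.mpr h) (le_max_left _ _)).trans
    (hF.logMax_le_integral hη (exp_neg_mem n))

end HasHardyBound

end

/-! ### Propagation of equality along coordinates -/

section

variable {F : (ℕ → ℂ) → ℂ}

/-- The Herglotz transform in the `k`-th variable. -/
def herglotz (G : (ℕ → Circle) → ℝ) (k : ℕ) (z : ℂ) : ℂ :=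
  ∫ w, ((w k : ℂ) + z) / ((w k : ℂ) - z) * (G w : ℂ) ∂torusMeasure

lemma circle_sub_ne_zero {z : ℂ} (hz : ‖z‖ < 1) (u : Circle) : (u : ℂ) - z ≠ 0 := by
  have := norm_sub_circle_pos hz u
  rw [norm_sub_rev] at this
  exact norm_pos_iff.mp this

lemma continuous_herglotz_kernel {z : ℂ} (hz : ‖z‖ < 1) (k : ℕ) :
    Continuous fun w : ℕ → Circle => ((w k : ℂ) + z) / ((w k : ℂ) - z) :=
  Continuous.div (by fun_prop) (by fun_prop) fun w => circle_sub_ne_zero hz (w k)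

lemma integrable_herglotz {G : (ℕ → Circle) → ℝ} (hG : Integrable G torusMeasure) {z : ℂ}
    (hz : ‖z‖ < 1) (k : ℕ) :
    Integrable (fun w => ((w k : ℂ) + z) / ((w k : ℂ) - z) * (G w : ℂ)) torusMeasure := by
  have hc := continuous_herglotz_kernel hz k
  obtain ⟨B, hB⟩ := isCompact_univ.exists_bound_of_continuousOn hc.continuousOn
  exact hG.ofReal.bdd_mul hc.measurable.aestronglyMeasurable (.of_forall fun w => hB w trivial)

lemma re_herglotz {G : (ℕ → Circle) → ℝ} (hG : Integrable G torusMeasure) {z : ℂ}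
    (hz : ‖z‖ < 1) (k : ℕ) :
    (herglotz G k z).re = ∫ w, diskPoisson z (w k) * G w ∂torusMeasure := by
  have := integral_re (integrable_herglotz hG hz k)
  rw [herglotz]
  refine this.symm.trans (integral_congr_ae (.of_forall fun w => ?_))
  simp [diskPoisson_eq_re]

lemma differentiableOn_herglotz {G : (ℕ → Circle) → ℝ} (hG : Integrable G torusMeasure) (k : ℕ) :
    DifferentiableOn ℂ (herglotz G k) (Metric.ball 0 1) := by
  intro z hz
  rw [mem_ball_zero_iff] at hz
  set δ : ℝ := (1 - ‖z‖) / 2 with hδ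
  have hδ0 : 0 < δ := by rw [hδ]; linarith
  have hnear : ∀ x ∈ Metric.ball z δ, ‖x‖ < 1 - δ := by
    intro x hx
    rw [mem_ball_iff_norm] at hx
    have := norm_le_norm_add_norm_sub' x z
    linarith
  have h := hasDerivAt_integral_of_dominated_loc_of_deriv_le (μ := torusMeasure) (𝕜 := ℂ)
    (F := fun x w => ((w k : ℂ) + x) / ((w k : ℂ) - x) * (G w : ℂ))
    (F' := fun x w => 2 * (w k : ℂ) / ((w k : ℂ) - x) ^ 2 * (G w : ℂ))
    (bound := fun w => 2 / δ ^ 2 * ‖G w‖) (x₀ := z) (Metric.ball_mem_nhds z hδ0) ?_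
    (integrable_herglotz hG hz k) ?_ ?_ (hG.norm.const_mul _) ?_
  · exact h.2.differentiableAt.differentiableWithinAt
  · filter_upwards [Metric.ball_mem_nhds z hδ0] with x hx
    exact (integrable_herglotz hG (by linarith [hnear x hx]) k).aestronglyMeasurable
  · refine AEStronglyMeasurable.mul ?_ hG.ofReal.aestronglyMeasurable
    have : Continuous fun w : ℕ → Circle => 2 * (w k : ℂ) / ((w k : ℂ) - z) ^ 2 :=
      Continuous.div (by fun_prop) (by fun_prop) fun w => pow_ne_zero 2 (circle_sub_ne_zero hz (w k))
    exact this.measurable.aestronglyMeasurable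
  · refine .of_forall fun w x hx => ?_
    have h1 := one_sub_norm_le_norm_sub_circle x (w k)
    have h2 : δ ≤ ‖(w k : ℂ) - x‖ := by rw [norm_sub_rev]; linarith [hnear x hx]
    rw [norm_mul, norm_div, norm_mul, norm_pow, Circle.norm_coe, Complex.norm_real]
    norm_num
    gcongr
  · refine .of_forall fun w x hx => HasDerivAt.mul_const ?_ _
    have hne := circle_sub_ne_zero (by linarith [hnear x hx] : ‖x‖ < 1) (w k)
    have hder := ((hasDerivAt_id x).const_add (w k : ℂ)).div
      ((hasDerivAt_id x).const_sub (w k : ℂ)) hne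
    refine hder.congr_deriv ?_
    simp only [id]
    ring

/-- Equality in `norm_le_exp_integral` is preserved by a change of one coordinate. -/
lemma HasHardyBound.norm_eq_update {q : ℝ} {C : ℝ≥0∞} (hF : HasHardyBound F q C) {ζ : ℕ → ℂ}
    (hζ : ζ ∈ polydiskOne)
    (heq : ‖F ζ‖ = Real.exp (∫ w, torusPoissonKernel ζ w * Real.log ‖radialLimit F w‖ ∂torusMeasure))
    (k : ℕ) {b : ℂ} (hb : ‖b‖ < 1) :
    ‖F (Function.update ζ k b)‖ = Real.exp (∫ w, torusPoissonKernel (Function.update ζ k b) w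
      * Real.log ‖radialLimit F w‖ ∂torusMeasure) := by
  have h0 : F ζ ≠ 0 := by
    rw [← norm_pos_iff, heq]; exact Real.exp_pos _
  have hlog := hF.integrable_log hζ h0
  -- G collects the factors of the kernel other than the k-th, so it does not depend on z; only the
  -- disk kernel in wₖ remains for the Herglotz transform.
  set G : (ℕ → Circle) → ℝ := fun w =>
    torusPoissonKernel (Function.update ζ k 0) w * Real.log ‖radialLimit F w‖ with hGdef
  have hG : Integrable G torusMeasure :=
    integrable_torusPoissonKernel_mul (update_mem_polydiskOne hζ k (by simp)) hlog
  have hre : ∀ z : ℂ, ‖z‖ < 1 → (herglotz G k z).re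
      = ∫ w, torusPoissonKernel (Function.update ζ k z) w * Real.log ‖radialLimit F w‖
        ∂torusMeasure := by
    intro z hz
    rw [re_herglotz hG hz]
    refine integral_congr_ae (.of_forall fun w => ?_)
    simp only [hGdef, torusPoissonKernel_update hζ k hz w]
    ring
  -- |g| is the ratio of the two sides of the majorant: at most 1 everywhere, and 1 at ζₖ by
  -- hypothesis.
  set g : ℂ → ℂ := fun z => F (Function.update ζ k z) * Complex.exp (-herglotz G k z) with hg
  have hgd : DifferentiableOn ℂ g (Metric.ball 0 1) :=
    (hF.hol.differentiableOn_update hζ k).mul (differentiableOn_herglotz hG k).neg.cexp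
  have hgn : ∀ z : ℂ, ‖z‖ < 1 → ‖g z‖ = ‖F (Function.update ζ k z)‖
      / Real.exp (∫ w, torusPoissonKernel (Function.update ζ k z) w
        * Real.log ‖radialLimit F w‖ ∂torusMeasure) := by
    intro z hz
    rw [hg, norm_mul, Complex.norm_exp, Complex.neg_re, hre z hz, Real.exp_neg, div_eq_mul_inv]
  have hk : ‖ζ k‖ < 1 := hζ.2 k
  have hgk : ‖g (ζ k)‖ = 1 := by
    rw [hgn _ hk, Function.update_eq_self, heq, div_self (Real.exp_pos _).ne']
  have hmax : IsMaxOn (norm ∘ g) (Metric.ball 0 1) (ζ k) := by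
    intro z hz
    rw [mem_ball_zero_iff] at hz
    change ‖g z‖ ≤ ‖g (ζ k)‖
    rw [hgk, hgn z hz, div_le_one (Real.exp_pos _)]
    exact hF.norm_le_exp_integral ⟨ζ, hζ, h0⟩ (update_mem_polydiskOne hζ k hz)
  have := Complex.norm_eqOn_of_isPreconnected_of_isMaxOn (convex_ball (0 : ℂ) 1).isPreconnected
    Metric.isOpen_ball hgd (by simpa using hk) hmax (show b ∈ Metric.ball 0 1 by simpa using hb)
  simp only [Function.comp, Function.const, hgk] at this
  rwa [hgn b hb, div_eq_one_iff_eq (Real.exp_pos _).ne'] at this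

/-- The sequence with the first `N` terms of `η` followed by the terms of `ζ`. -/
def splice (N : ℕ) (η ζ : ℕ → ℂ) (n : ℕ) : ℂ := if n < N then η n else ζ n

lemma splice_zero (η ζ : ℕ → ℂ) : splice 0 η ζ = ζ := by ext n; simp [splice]

lemma splice_succ (N : ℕ) (η ζ : ℕ → ℂ) :
    splice (N + 1) η ζ = Function.update (splice N η ζ) N (η N) := by
  ext n
  rcases eq_or_ne n N with rfl | h
  · simp [splice]
  · have : n < N + 1 ↔ n < N := by omega
    simp [splice, h, this]

lemma splice_mem_polydiskOne {η ζ : ℕ → ℂ} (hζ : ζ ∈ polydiskOne) (hη : ∀ n, ‖η n‖ < 1) (N : ℕ) :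
    splice N η ζ ∈ polydiskOne := by
  induction N with
  | zero => rwa [splice_zero]
  | succ N ih => rw [splice_succ]; exact update_mem_polydiskOne ih N (hη N)

lemma HasHardyBound.splice_ne_zero {q : ℝ} {C : ℝ≥0∞} (hF : HasHardyBound F q C) {ζ : ℕ → ℂ}
    (hζ : ζ ∈ polydiskOne)
    (heq : ‖F ζ‖ = Real.exp (∫ w, torusPoissonKernel ζ w * Real.log ‖radialLimit F w‖ ∂torusMeasure))
    {η : ℕ → ℂ} (hη : ∀ n, ‖η n‖ < 1) (N : ℕ) : F (splice N η ζ) ≠ 0 := by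
  have key : ‖F (splice N η ζ)‖ = Real.exp (∫ w, torusPoissonKernel (splice N η ζ) w
      * Real.log ‖radialLimit F w‖ ∂torusMeasure) := by
    induction N with
    | zero => rwa [splice_zero]
    | succ N ih =>
      rw [splice_succ]
      exact hF.norm_eq_update (splice_mem_polydiskOne hζ hη N) ih N (hη N)
  rw [← norm_pos_iff, key]
  exact Real.exp_pos _

/-! ### Hurwitz argument -/

/-- The minimum principle, that is, the maximum principle for 1/f. -/
lemma exists_mem_sphere_norm_le {f : ℂ → ℂ} {r : ℝ} (hr : 0 < r)
    (hf : DiffContOnCl ℂ f (Metric.ball 0 r)) (h0 : ∀ z ∈ Metric.closedBall (0 : ℂ) r, f z ≠ 0) :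
    ∃ z ∈ Metric.sphere (0 : ℂ) r, ‖f z‖ ≤ ‖f 0‖ := by
  have hcl : closure (Metric.ball (0 : ℂ) r) = Metric.closedBall 0 r := closure_ball _ hr.ne'
  have hc : ContinuousOn f (Metric.sphere 0 r) :=
    hf.continuousOn.mono (hcl ▸ Metric.sphere_subset_closedBall)
  obtain ⟨z, hz, hmin⟩ := (isCompact_sphere (0 : ℂ) r).exists_isMinOn
    (NormedSpace.sphere_nonempty.mpr hr.le) hc.norm
  refine ⟨z, hz, ?_⟩
  have hzpos : 0 < ‖f z‖ := norm_pos_iff.mpr (h0 z (Metric.sphere_subset_closedBall hz))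
  have := Complex.norm_le_of_forall_mem_frontier_norm_le (C := ‖f z‖⁻¹) Metric.isBounded_ball
    (hf.inv fun x hx => h0 x (hcl ▸ hx)) (fun x hx => by
      rw [frontier_ball _ hr.ne'] at hx
      rw [Pi.inv_apply, norm_inv]
      exact inv_anti₀ hzpos (hmin hx)) (z := 0) (subset_closure (by simpa using hr))
  rw [Pi.inv_apply, norm_inv] at this
  exact (inv_le_inv₀ (norm_pos_iff.mpr (h0 0 (by simp [hr.le]))) hzpos).mp this

/-- A Hurwitz type theorem: a function on `𝔻₂^∞` has no zeros if all its values at finite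
modifications of a given point are nonzero. -/
lemma HolomorphicOnPolydiskTwo.ne_zero_of_splice (hF : HolomorphicOnPolydiskTwo F) {ζ : ℕ → ℂ}
    (hζ : ζ ∈ polydiskOne)
    (h : ∀ η : ℕ → ℂ, (∀ n, ‖η n‖ < 1) → ∀ N, F (splice N η ζ) ≠ 0)
    {η : ℕ → ℂ} (hη : η ∈ polydiskTwo) : F η ≠ 0 := by
  intro hzero
  have hζ2 := polydiskOne_subset hζ
  have hv : Memℓp (ζ - η) 2 := hζ2.1.sub hη.1
  set line : ℂ → ℕ → ℂ := fun z n => η n + z * (ζ - η) n with hline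
  set U : Set ℂ := {z | ∀ n, ‖line z n‖ < 1} with hU
  have hUmem : ∀ z ∈ U, line z ∈ polydiskTwo := fun z hz =>
    ⟨hη.1.add (hv.const_smul z), hz⟩
  have hUopen : IsOpen U := by
    have h1 : Continuous fun z : ℂ => (⟨η, hη.1⟩ : lp (fun _ : ℕ => ℂ) 2) + z • ⟨ζ - η, hv⟩ :=
      continuous_const.add (continuous_id.smul continuous_const)
    have h2 := isOpen_polydiskTwo.preimage h1
    convert h2 using 1
    ext z
    exact ⟨fun hz => hUmem z hz, fun hz => hz.2⟩
  have hUconv : Convex ℝ U := by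
    intro x hx y hy a b ha hb hab n
    have h1 : line (a • x + b • y) n = (a : ℂ) * line x n + (b : ℂ) * line y n := by
      have : (a : ℂ) + b = 1 := by exact_mod_cast hab
      simp only [hline, Complex.real_smul]
      linear_combination (-η n) * this
    rw [h1]
    have h2 := norm_add_le ((a : ℂ) * line x n) ((b : ℂ) * line y n)
    rw [norm_mul, norm_mul, Complex.norm_real, Complex.norm_real, Real.norm_of_nonneg ha,
      Real.norm_of_nonneg hb] at h2
    have h3 : max ‖line x n‖ ‖line y n‖ < 1 := max_lt (hx n) (hy n)
    have h4 := mul_le_mul_of_nonneg_left (le_max_left ‖line x n‖ ‖line y n‖) ha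
    have h5 := mul_le_mul_of_nonneg_left (le_max_right ‖line x n‖ ‖line y n‖) hb
    have h6 : a * max ‖line x n‖ ‖line y n‖ + b * max ‖line x n‖ ‖line y n‖
        = max ‖line x n‖ ‖line y n‖ := by rw [← add_mul, hab, one_mul]
    linarith
  have hl0 : line 0 = η := by ext n; simp [hline]
  have hl1 : line 1 = ζ := by ext n; simp [hline]
  have h0U : (0 : ℂ) ∈ U := fun n => by rw [hl0]; exact hη.2 n
  have h1U : (1 : ℂ) ∈ U := fun n => by rw [hl1]; exact hζ.2 n
  set f : ℂ → ℂ := fun z => F (line z) with hf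
  have hfd : DifferentiableOn ℂ f U := hF.differentiableOn_line hη.1 hv hUmem
  have hfan : AnalyticOnNhd ℂ f U := hfd.analyticOnNhd hUopen
  -- U is convex and contains 1, where f takes the value F(ζ) ≠ 0, so the zero at 0 is isolated.
  have hne : ∀ᶠ z in 𝓝[≠] (0 : ℂ), f z ≠ 0 := by
    by_contra hcon
    rw [Filter.not_eventually] at hcon
    have := hfan.eqOn_zero_of_preconnected_of_frequently_eq_zero hUconv.isPreconnected h0U
      (hcon.mono fun z hz => not_not.mp hz) h1U
    have h2 := h ζ hζ.2 0
    rw [splice_zero, ← hl1] at h2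
    exact h2 this
  obtain ⟨ε, hε, hball⟩ := Metric.eventually_nhds_iff_ball.mp
    ((eventually_nhdsWithin_iff.mp hne).and (hUopen.mem_nhds h0U))
  set r : ℝ := min (ε / 2) 1 with hr
  have hr0 : 0 < r := lt_min (half_pos hε) one_pos
  have hr1 : r ≤ 1 := min_le_right _ _
  have hrε : Metric.closedBall (0 : ℂ) r ⊆ Metric.ball 0 ε :=
    Metric.closedBall_subset_ball ((min_le_left _ _).trans_lt (half_lt_self hε))
  have hrU : Metric.closedBall (0 : ℂ) r ⊆ U := fun z hz => (hball z (hrε hz)).2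
  have hsplice : ∀ N z, splice N (line z) ζ
      = fun n => splice N η ζ n + z * (ζ - splice N η ζ) n := by
    intro N z
    ext n
    by_cases hn : n < N <;> simp [splice, hline, hn]
  -- The spliced functions are zero-free on the closed disk, so each has a point on the circle where
  -- it is no larger than at 0. At 0 they tend to F(η) = 0, so a limit point of these points would
  -- be a zero of f on the circle.
  have hex : ∀ N, ∃ z ∈ Metric.sphere (0 : ℂ) r, ‖F (splice N (line z) ζ)‖
      ≤ ‖F (splice N (line 0) ζ)‖ := by
    intro N
    refine exists_mem_sphere_norm_le (f := fun z => F (splice N (line z) ζ)) hr0 ?_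
      fun z hz => h _ (hrU hz) N
    refine DifferentiableOn.diffContOnCl ?_
    rw [closure_ball _ hr0.ne']
    simp_rw [hsplice]
    have hm := polydiskOne_subset (splice_mem_polydiskOne hζ hη.2 N)
    refine hF.differentiableOn_line hm.1 (hζ2.1.sub hm.1) fun z hz => ?_
    rw [← hsplice]
    exact polydiskOne_subset (splice_mem_polydiskOne hζ (hrU hz) N)
  choose z hz hle using hex
  obtain ⟨z₀, hz₀, φ, hφ, hlim⟩ := (isCompact_sphere (0 : ℂ) r).tendsto_subseq hz
  -- A square-summable majorant for all spliced points with |z| ≤ 1, as |η + z(ζ - η)| ≤ 2|η| + |ζ|;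
  -- it supplies the domination needed for convergence of F.
  have hb : Summable fun n => (2 * ‖η n‖ + ‖ζ n‖) ^ 2 := by
    refine (((mem_polydiskTwo.mp hη).1.mul_left 8).add
      ((mem_polydiskTwo.mp hζ2).1.mul_left 2)).of_nonneg_of_le (fun n => sq_nonneg _) fun n => ?_
    nlinarith [sq_nonneg (2 * ‖η n‖ - ‖ζ n‖)]
  have hlb : ∀ x ∈ Metric.closedBall (0 : ℂ) r, ∀ n, ‖line x n‖ ≤ 2 * ‖η n‖ + ‖ζ n‖ := by
    intro x hx n
    rw [mem_closedBall_zero_iff] at hx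
    have h1 := norm_add_le (η n) (x * (ζ - η) n)
    have h2 := norm_sub_le (ζ n) (η n)
    rw [norm_mul] at h1
    have h3 : ‖x‖ * ‖(ζ - η) n‖ ≤ 1 * ‖(ζ - η) n‖ := by gcongr; exact hx.trans hr1
    have h4 : ‖(ζ - η) n‖ = ‖ζ n - η n‖ := rfl
    simp only [hline]
    linarith
  have hsb : ∀ N, ∀ x ∈ Metric.closedBall (0 : ℂ) r, ∀ n,
      ‖splice N (line x) ζ n‖ ≤ 2 * ‖η n‖ + ‖ζ n‖ ∧ ‖splice N (line x) ζ n‖ < 1 := by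
    intro N x hx n
    refine ⟨?_, (splice_mem_polydiskOne hζ (hrU hx) N).2 n⟩
    unfold splice
    split_ifs
    · exact hlb x hx n
    · linarith [norm_nonneg (η n)]
  have hconv : ∀ (x : ℕ → ℂ) (x₀ : ℂ), (∀ N, x N ∈ Metric.closedBall (0 : ℂ) r) →
      x₀ ∈ Metric.closedBall (0 : ℂ) r → Tendsto x atTop (𝓝 x₀) →
      Tendsto (fun N => F (splice (φ N) (line (x N)) ζ)) atTop (𝓝 (f x₀)) := by
    intro x x₀ hx hx₀ hlim
    refine hF.tendsto hb (.of_forall fun N => hsb _ _ (hx N))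
      (fun n => ⟨hlb x₀ hx₀ n, hrU hx₀ n⟩) fun n => ?_
    have h1 : Tendsto (fun N => line (x N) n) atTop (𝓝 (line x₀ n)) :=
      (hlim.mul_const _).const_add _
    refine h1.congr' ?_
    filter_upwards [hφ.tendsto_atTop.eventually_gt_atTop n] with N hN
    simp [splice, hN]
  have hA := hconv (z ∘ φ) z₀ (fun N => Metric.sphere_subset_closedBall (hz _))
    (Metric.sphere_subset_closedBall hz₀) hlim
  have hB := hconv (fun _ => 0) 0 (fun N => by simp [hr0.le]) (by simp [hr0.le]) tendsto_const_nhds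
  have hfin := le_of_tendsto_of_tendsto' hA.norm hB.norm fun N => hle (φ N)
  have hf0 : f 0 = 0 := by simp only [hf]; rw [hl0, hzero]
  rw [hf0, norm_zero, norm_le_zero_iff] at hfin
  refine (hball z₀ (hrε (Metric.sphere_subset_closedBall hz₀))).1 ?_ hfin
  rintro rfl
  simp [hr0.ne] at hz₀

end

end InfPolydisk

end

theorem corollary2p17 (p : ℝ≥0∞) (hp : 0 < p) (F : (ℕ → ℂ) → ℂ)
    (hF : InfPolydisk.MemHardy p F) (hout : InfPolydisk.IsOuter F) :
    ∀ ζ ∈ InfPolydisk.polydiskTwo, F ζ ≠ 0 := by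
  obtain ⟨q, C, hH⟩ := hF.exists_hasHardyBound hp
  obtain ⟨-, ζ, hζ, heq⟩ := hout
  -- The integral is a real number, so the left side of the outer equality cannot be log 0 = -∞.
  have h0 : F ζ ≠ 0 := by
    intro h0
    rw [h0, enorm_zero, ENNReal.log_zero] at heq
    exact EReal.bot_ne_coe _ heq
  have hnorm : ‖F ζ‖ = Real.exp (∫ w, InfPolydisk.torusPoissonKernel ζ w
      * Real.log ‖InfPolydisk.radialLimit F w‖ ∂InfPolydisk.torusMeasure) := by
    rw [ENNReal.log_pos_real (by simpa using h0) enorm_ne_top, EReal.coe_eq_coe_iff,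
      toReal_enorm] at heq
    rw [← heq, Real.exp_log (norm_pos_iff.mpr h0)]
  exact fun η hη => hF.1.ne_zero_of_splice hζ (fun η' hη' N => hH.splice_ne_zero hζ hnorm hη' N) hη
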